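/- **Theorem (Single-Fork Latency and Cost).** Let $F_X$ be the distribution function of a nonnegative random variable $X$, and put $\bar F_X = 1-F_X$ and $F_X^{-1}(h)=\inf\{x : F_X(x)\ge h\}$. Let $0<p<1$, let $r\ge 0$ be an integer and $l\in\{0,1\}$. The single-fork policy $\pi(p,r,l)$ runs a job of $n$ tasks with $m_n$ stragglers as follows, where $m_n$ is an integer with $|m_n-pn|<1$ (so $m_n=pn$ if $pn$ is an integer): at time $0$ it launches one copy of each of the $n$ tasks; when $n-m_n$ tasks have finished (the forking point) it treats each of the $m_n$ remaining tasks in the same way: if $l=1$, it keeps the original copy and launches $r$ new replicas, and if $l=0$, it kills the original copy and launches $r+1$ new replicas. When the earliest replica of a task finishes, its other replicas are killed. The execution times of all copies and replicas are i.i.d. with distribution function $F_X$. Let $T$ be the time by which every task has finished, and let $C$ be $\frac1n$ times the sum, over all copies and replicas, of the time from launch until finish or kill. Let $Y\ge 0$ have the tail distribution function, for $y\ge 0$, $$\bar F_Y(y)=\begin{cases}\bar F_X(y)^{r+1} & \text{if } l=0,\\ \frac1p\,\bar F_X(y)^r\,\bar F_X\bigl(y+F_X^{-1}(1-p)\bigr)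 & \text{if } l=1,\end{cases}$$ and let $Y_{m:m}$ be the maximum of $m$ i.i.d. copies of $Y$. Suppose that $E[Y]<\infty$ and that $F_X(y)>1-p$ for every $y>F_X^{-1}(1-p)$ (the $(1-p)$-quantile of $X$ is unique). Then $E[T]$, $E[C]$ and $E[Y_{m_n:m_n}]$ are finite for all sufficiently large $n$, and as $n\to\infty$ $$E[T]-\Bigl(F_X^{-1}(1-p)+E[Y_{m_n:m_n}]\Bigr)\to 0,$$ $$E[C]\to\int_0^{1-p}F_X^{-1}(h)\,dh+p\,F_X^{-1}(1-p)+(r+1)\,p\,E[Y].$$ -/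

import Mathlib

open MeasureTheory ProbabilityTheory Filter Topology Set

noncomputable section

namespace SingleFork

/-- A single-fork scheduling policy `π(p, r, l)`: `p` is the fraction of straggling tasks,
`r` the number of additional replicas, and `l` the number of original replicas of a straggling
task that are kept at the forking point (`l = 0`: relaunching, `l = 1`: no relaunching). -/
structure Policy where
  p : ℝ
  r : ℕ
  l : Fin 2
  p_pos : 0 < p
  p_lt_one : p < 1

/-! ### Distribution functions -/

/-- The tail distribution function `1 - F_X` of the law `μ` of `X`. -/
def tail (μ : Measure ℝ) (x : ℝ) : ℝ := 1 - cdf μ x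

/-- The inverse distribution function `F_X⁻¹(h) = inf {x | F_X(x) ≥ h}`. -/
def quantile (μ : Measure ℝ) (h : ℝ) : ℝ := sInf {x : ℝ | h ≤ cdf μ x}

/-- The tail distribution function of the residual straggler time `Y`, on `y ≥ 0`. -/
def residualTail (μ : Measure ℝ) (pol : Policy) (y : ℝ) : ℝ :=
  if pol.l = 0 then tail μ y ^ (pol.r + 1)
  else 1 / pol.p * tail μ y ^ pol.r * tail μ (y + quantile μ (1 - pol.p))

/-! #### `y ↦ 1 - residualTail y` (extended by `0` to `y < 0`) is a distribution function -/

theorem tail_nonneg (μ : Measure ℝ) (x : ℝ) : 0 ≤ tail μ x :=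
  sub_nonneg.2 (cdf_le_one μ x)

theorem tail_le_one (μ : Measure ℝ) (x : ℝ) : tail μ x ≤ 1 :=
  sub_le_self 1 (cdf_nonneg μ x)

theorem tail_antitone (μ : Measure ℝ) : Antitone (tail μ) := fun _ _ h =>
  sub_le_sub_left (monotone_cdf μ h) 1

theorem tail_right_continuous (μ : Measure ℝ) (x : ℝ) :
    ContinuousWithinAt (tail μ) (Ici x) x :=
  continuousWithinAt_const.sub ((cdf μ).right_continuous x)

theorem tail_quantile_le (μ : Measure ℝ) {p : ℝ} (hp0 : 0 < p) :
    tail μ (quantile μ (1 - p)) ≤ p := by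
  have hne : {x : ℝ | 1 - p ≤ cdf μ x}.Nonempty := by
    have h := (tendsto_cdf_atTop μ).eventually (lt_mem_nhds (show 1 - p < 1 by linarith))
    obtain ⟨x, hx⟩ := h.exists
    exact ⟨x, hx.le⟩
  have key : ∀ y, quantile μ (1 - p) < y → tail μ y ≤ p := by
    intro y hy
    obtain ⟨x, hx, hxy⟩ := exists_lt_of_csInf_lt hne hy
    have h1 : 1 - p ≤ cdf μ x := hx
    have h2 := monotone_cdf μ hxy.le
    unfold tail
    linarith
  have hlim : Tendsto (tail μ) (𝓝[>] quantile μ (1 - p)) (𝓝 (tail μ (quantile μ (1 - p)))) :=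
    (tail_right_continuous μ _).mono_left (nhdsWithin_mono _ Ioi_subset_Ici_self)
  exact le_of_tendsto hlim (eventually_nhdsWithin_of_forall key)

theorem residualTail_nonneg (μ : Measure ℝ) (pol : Policy) (y : ℝ) :
    0 ≤ residualTail μ pol y := by
  have hp := pol.p_pos
  have h1 := tail_nonneg μ y
  have h2 := tail_nonneg μ (y + quantile μ (1 - pol.p))
  unfold residualTail
  split_ifs <;> positivity

theorem residualTail_antitone (μ : Measure ℝ) (pol : Policy) :
    Antitone (residualTail μ pol) := by
  intro a b hab
  have hp := pol.p_pos
  have h1 := tail_nonneg μ b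
  have h2 := tail_nonneg μ (b + quantile μ (1 - pol.p))
  have h3 := tail_antitone μ hab
  have h4 := tail_antitone μ (show a + quantile μ (1 - pol.p) ≤ b + quantile μ (1 - pol.p) by
    linarith)
  have h5 := tail_nonneg μ a
  unfold residualTail
  split_ifs <;> gcongr

theorem residualTail_le_one (μ : Measure ℝ) (pol : Policy) {y : ℝ} (hy : 0 ≤ y) :
    residualTail μ pol y ≤ 1 := by
  have hp := pol.p_pos
  have h1 := tail_nonneg μ y
  have h2 := tail_nonneg μ (y + quantile μ (1 - pol.p))
  unfold residualTail
  split_ifs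
  · exact pow_le_one₀ h1 (tail_le_one μ y)
  · have h3 : tail μ (y + quantile μ (1 - pol.p)) ≤ pol.p :=
      (tail_antitone μ (by linarith)).trans (tail_quantile_le μ hp)
    calc 1 / pol.p * tail μ y ^ pol.r * tail μ (y + quantile μ (1 - pol.p))
        ≤ 1 / pol.p * 1 * pol.p := by
          gcongr
          exact pow_le_one₀ h1 (tail_le_one μ y)
      _ = 1 := by field_simp

theorem residualTail_right_continuous (μ : Measure ℝ) (pol : Policy) (y : ℝ) :
    ContinuousWithinAt (residualTail μ pol) (Ici y) y := by
  have h1 := tail_right_continuous μ y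
  have h2 : ContinuousWithinAt (fun z => tail μ (z + quantile μ (1 - pol.p))) (Ici y) y := by
    have hadd : ContinuousWithinAt (fun z : ℝ => z + quantile μ (1 - pol.p)) (Ici y) y := by
      fun_prop
    refine ContinuousWithinAt.comp (g := tail μ) (t := Ici (y + quantile μ (1 - pol.p)))
      (tail_right_continuous μ _) hadd ?_
    intro z hz
    have hz' : y ≤ z := hz
    show y + quantile μ (1 - pol.p) ≤ z + quantile μ (1 - pol.p)
    linarith
  unfold residualTail
  split_ifs
  · exact h1.pow _
  · exact (continuousWithinAt_const.mul (h1.pow _)).mul h2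

/-- The distribution function `F_Y` of the residual straggler time `Y`. -/
def residualCDF (μ : Measure ℝ) (pol : Policy) : StieltjesFunction ℝ where
  toFun y := if y < 0 then 0 else 1 - residualTail μ pol y
  mono' := by
    intro a b hab
    dsimp only
    split_ifs with ha hb hb
    · exact le_rfl
    · exact sub_nonneg.2 (residualTail_le_one μ pol (not_lt.1 hb))
    · exact absurd (hab.trans_lt hb) ha
    · exact sub_le_sub_left (residualTail_antitone μ pol hab) 1
  right_continuous' := by
    intro y
    rcases lt_or_ge y 0 with hy | hy
    · have h : (fun z : ℝ => if z < 0 then (0 : ℝ) else 1 - residualTail μ pol z)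
          =ᶠ[𝓝 y] fun _ => 0 := by
        filter_upwards [gt_mem_nhds hy] with z hz
        exact if_pos hz
      exact (continuousAt_const.congr h.symm).continuousWithinAt
    · have h : ContinuousWithinAt (fun z => 1 - residualTail μ pol z) (Ici y) y :=
        continuousWithinAt_const.sub (residualTail_right_continuous μ pol y)
      refine h.congr ?_ ?_
      · intro z hz
        exact if_neg (not_lt.2 (hy.trans hz))
      · exact if_neg (not_lt.2 hy)

/-- The law of `Y`: the probability distribution with distribution function `F_Y`. -/
def residualLaw (μ : Measure ℝ) (pol : Policy) : Measure ℝ := (residualCDF μ pol).measure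

/-! ### Execution of a job

A job has `n` tasks, of which `m` are stragglers.  `x i` is the execution time of the original
copy of task `i`.  After the forking point, `r + 1` replicas `j` of each straggling task are
running; `z i j` is the execution time of replica `j` of task `i` if that replica is new.  When
`l = 1`, replica `0` is the original copy, and then `z i 0` is not used. -/

/-- The `k`-th smallest of `x 0, …, x (n - 1)`, for `1 ≤ k ≤ n`; it is `0` for `k = 0`. -/
def orderStat {n : ℕ} (x : Fin n → ℝ) (k : ℕ) : ℝ :=
  if h : 0 < k ∧ k ≤ n then x (Tuple.sort x ⟨k - 1, by omega⟩) else 0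

/-- The forking point: the time at which `n - m` tasks have finished. -/
def forkTime {n : ℕ} (m : ℕ) (x : Fin n → ℝ) : ℝ := orderStat x (n - m)

/-- Task `i` is not among the first `n - m` tasks that finish (ties are broken by index). -/
def IsStraggler {n : ℕ} (m : ℕ) (x : Fin n → ℝ) (i : Fin n) : Prop :=
  n - m ≤ ((Tuple.sort x).symm i : ℕ)

/-- Replica `j` of a straggling task is its original copy. -/
def IsOriginal (pol : Policy) (j : Fin (pol.r + 1)) : Prop := pol.l = 1 ∧ j = 0

open Classical in
/-- The time at which replica `j` of the straggling task `i` would finish if it were not killed. -/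
def replicaFinish (pol : Policy) {n : ℕ} (m : ℕ) (x : Fin n → ℝ)
    (z : Fin n → Fin (pol.r + 1) → ℝ) (i : Fin n) (j : Fin (pol.r + 1)) : ℝ :=
  if IsOriginal pol j then x i else forkTime m x + z i j

open Classical in
/-- The finish time `T_i` of the earliest replica of task `i`. -/
def taskFinish (pol : Policy) {n : ℕ} (m : ℕ) (x : Fin n → ℝ)
    (z : Fin n → Fin (pol.r + 1) → ℝ) (i : Fin n) : ℝ :=
  if IsStraggler m x i then ⨅ j, replicaFinish pol m x z i j else x i

/-- The latency `T = max_i T_i`. -/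
def latency (pol : Policy) {n : ℕ} (m : ℕ) (x : Fin n → ℝ)
    (z : Fin n → Fin (pol.r + 1) → ℝ) : ℝ :=
  ⨆ i, taskFinish pol m x z i

open Classical in
/-- The sum of the running times of all machines that run a copy of task `i`.  The copy of a task
that does not straggle runs until it finishes.  For a straggling task, an original copy that is not
kept runs from time `0` until it is killed at the forking point; a replica that runs after the
forking point does so until `T_i`, and was launched at time `0` if it is the original copy and at
the forking point if it is new. -/
def taskRunningTime (pol : Policy) {n : ℕ} (m : ℕ) (x : Fin n → ℝ)
    (z : Fin n → Fin (pol.r + 1) → ℝ) (i : Fin n) : ℝ :=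
  if IsStraggler m x i then
    (if pol.l = 0 then forkTime m x else 0) +
      ∑ j, (taskFinish pol m x z i - if IsOriginal pol j then 0 else forkTime m x)
  else x i

/-- The computing cost `C`: the running times of all machines, normalized by `n`. -/
def cost (pol : Policy) {n : ℕ} (m : ℕ) (x : Fin n → ℝ)
    (z : Fin n → Fin (pol.r + 1) → ℝ) : ℝ :=
  1 / (n : ℝ) * ∑ i, taskRunningTime pol m x z i

/-- The joint law of the execution times `(x, z)`: all of them are i.i.d. with law `μ`. -/
def jobLaw (μ : Measure ℝ) (pol : Policy) (n : ℕ) :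
    Measure ((Fin n → ℝ) × (Fin n → Fin (pol.r + 1) → ℝ)) :=
  (Measure.pi fun _ => μ).prod (Measure.pi fun _ => Measure.pi fun _ => μ)

/-- The expected latency `E[T]` of a job with `n` tasks and `m` stragglers. -/
def expectedLatency (μ : Measure ℝ) (pol : Policy) (n m : ℕ) : ℝ :=
  ∫ ω, latency pol m ω.1 ω.2 ∂(jobLaw μ pol n)

/-- The expected cost `E[C]` of a job with `n` tasks and `m` stragglers. -/
def expectedCost (μ : Measure ℝ) (pol : Policy) (n m : ℕ) : ℝ :=
  ∫ ω, cost pol m ω.1 ω.2 ∂(jobLaw μ pol n)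

/-- `E[Y]`. -/
def expectedResidual (μ : Measure ℝ) (pol : Policy) : ℝ := ∫ y, y ∂(residualLaw μ pol)

/-- `E[Y_{m:m}]`, the expected maximum of `m` i.i.d. random variables with law `F_Y`. -/
def expectedMaxResidual (μ : Measure ℝ) (pol : Policy) (m : ℕ) : ℝ :=
  ∫ y : Fin m → ℝ, (⨆ j, y j) ∂(Measure.pi fun _ => residualLaw μ pol)

end SingleFork

end

/-!
Let `S` be the forking point, `q = F_X⁻¹(1 - p)` and `D = |S - q|`.  The proof replaces the random
forking point by the deterministic one `q`, at a cost controlled by `E[D]`, and then computes.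

**Replacing `S` by `q`.**  To each task a residual time `U i` (`residual`) is attached, which is the
minimum over its replicas of the new execution times and, if the original copy is kept, of
`(x i - q)⁺`.  When the originals are kept, it is defined for all `n` tasks, because a task that
finishes before `q` has `U i = 0`; when they are killed, it is set to `0` for the tasks that are not
stragglers.  For every outcome with nonnegative replica times, the latency is within `2 D` of
`q + max U` (`abs_latency_sub_le`), and the cost is within `(r + 2) D` of the average of
`min (x i) q + (r + 1) U i` (`abs_cost_sub_le`).

**Convergence of `S`.**  `E[D] → 0` (`tendsto_integral_abs_forkTime_sub`) by dominated convergence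
for the tail of `D`.  It tends to `0` pointwise by Chebyshev's inequality and the uniqueness of the
quantile.  It is dominated because `S > q + y` forces more than `m` of the `n` execution times
above `q + y`, which by the factorial moment of order `r + 1` has probability at most
`(2 / p) ^ (r + 1) * tail (q + y) ^ (r + 1)`, and `tail (q + y) ^ (r + 1)` is at most the tail of
`Y`, which is integrable.

**The maximum.**  Let `t = t(y)` be the tail of `Y` at `y`.  If originals are killed, exactly `m`
i.i.d. copies of `Y` count, so that `E[max U] = E[Y_{m:m}]`.  If they are kept, the `U i` are `n`
i.i.d. variables with tail `p t`, and the two expectations differ by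
`∫ (1 - t) ^ m - (1 - p t) ^ n`.  Both may tend to infinity, but the integrand is bounded by
`4 t` uniformly in `n`, so dominated convergence applies (`tendsto_integral_pow_sub_pow`).

**The sum.**  `∑ E[U i]` is `m E[Y]` or `n p E[Y]` (`integral_sum_residual_eq`), and `E[min X q]` is
computed from the representation of `X` as the quantile function of a uniform variable
(`integral_min_quantile`).
-/

namespace SingleFork

/-! ### Order statistics -/

theorem orderStat_eq {n : ℕ} (x : Fin n → ℝ) {k : ℕ} (hk : 0 < k) (hkn : k ≤ n) :
    orderStat x k = x (Tuple.sort x ⟨k - 1, by omega⟩) :=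
  dif_pos ⟨hk, hkn⟩

open Classical in
theorem le_card_of_orderStat_le {n : ℕ} (x : Fin n → ℝ) {k : ℕ} (hk : 0 < k) (hkn : k ≤ n)
    {s : ℝ} (h : orderStat x k ≤ s) : k ≤ (Finset.univ.filter fun i => x i ≤ s).card := by
  rw [orderStat_eq x hk hkn] at h
  have hsub : (Finset.Iic (⟨k - 1, by omega⟩ : Fin n)).map (Tuple.sort x).toEmbedding ⊆
      Finset.univ.filter fun i => x i ≤ s := by
    intro i hi
    obtain ⟨j, hj, rfl⟩ := Finset.mem_map.1 hi
    simpa using (Tuple.monotone_sort x (Finset.mem_Iic.1 hj)).trans h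
  have hcard := Finset.card_le_card hsub
  rw [Finset.card_map, Fin.card_Iic] at hcard
  simp only at hcard
  omega

open Classical in
theorem lt_card_of_lt_orderStat {n : ℕ} (x : Fin n → ℝ) {k : ℕ} (hk : 0 < k) (hkn : k ≤ n)
    {s : ℝ} (h : s < orderStat x k) : n - k < (Finset.univ.filter fun i => s < x i).card := by
  rw [orderStat_eq x hk hkn] at h
  have hsub : (Finset.Ici (⟨k - 1, by omega⟩ : Fin n)).map (Tuple.sort x).toEmbedding ⊆
      Finset.univ.filter fun i => s < x i := by
    intro i hi
    obtain ⟨j, hj, rfl⟩ := Finset.mem_map.1 hi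
    simpa using h.trans_le (Tuple.monotone_sort x (Finset.mem_Ici.1 hj))
  have hcard := Finset.card_le_card hsub
  rw [Finset.card_map, Fin.card_Ici] at hcard
  simp only at hcard
  omega

theorem forkTime_le_of_isStraggler {n m : ℕ} (hmn : m < n) {x : Fin n → ℝ} {i : Fin n}
    (h : IsStraggler m x i) : forkTime m x ≤ x i := by
  rw [forkTime, orderStat_eq x (by omega) (by omega)]
  have hle : (⟨n - m - 1, by omega⟩ : Fin n) ≤ (Tuple.sort x).symm i := by
    rw [Fin.le_def]
    have : n - m ≤ ((Tuple.sort x).symm i : ℕ) := h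
    simp only
    omega
  simpa using Tuple.monotone_sort x hle

theorem le_forkTime_of_not_isStraggler {n m : ℕ} (hmn : m < n) {x : Fin n → ℝ} {i : Fin n}
    (h : ¬ IsStraggler m x i) : x i ≤ forkTime m x := by
  rw [forkTime, orderStat_eq x (by omega) (by omega)]
  have hle : (Tuple.sort x).symm i ≤ (⟨n - m - 1, by omega⟩ : Fin n) := by
    rw [Fin.le_def]
    have : ¬ n - m ≤ ((Tuple.sort x).symm i : ℕ) := h
    simp only
    omega
  simpa using Tuple.monotone_sort x hle

open Classical in
theorem card_isStraggler {n m : ℕ} (hmn : m ≤ n) (x : Fin n → ℝ) :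
    (Finset.univ.filter fun i => IsStraggler m x i).card = m := by
  have h : (Finset.univ.filter fun i => IsStraggler m x i) =
      (Finset.univ.filter fun j : Fin n => n - m ≤ (j : ℕ)).map (Tuple.sort x).toEmbedding := by
    ext i
    rw [Finset.mem_map_equiv, Finset.mem_filter, Finset.mem_filter]
    simp [IsStraggler]
  rw [h, Finset.card_map]
  have h2 := Finset.card_filter_add_card_filter_not (s := (Finset.univ : Finset (Fin n)))
    (fun j : Fin n => (j : ℕ) < n - m)
  rw [Fin.card_filter_val_lt] at h2
  simp only [not_lt, Finset.card_univ, Fintype.card_fin] at h2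
  omega

theorem exists_isStraggler {n m : ℕ} (hm : 0 < m) (hmn : m ≤ n) (x : Fin n → ℝ) :
    ∃ i, IsStraggler m x i := by
  classical
  have h := card_isStraggler hmn x
  obtain ⟨i, hi⟩ := Finset.card_pos.1 (h ▸ hm)
  exact ⟨i, (Finset.mem_filter.1 hi).2⟩

/-! ### Comparison of an execution with its deterministic-fork version -/

open Classical in
/-- The residual time of a task after the deterministic forking point `q`, when its original copy
has execution time `a` and its new replicas have execution times `b`.  If the original copy is
kept, it is replica `0`, and `b 0` is not used. -/
noncomputable def residualTime (pol : Policy) (q a : ℝ) (b : Fin (pol.r + 1) → ℝ) : ℝ :=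
  ⨅ j, if IsOriginal pol j then max (a - q) 0 else b j

open Classical in
/-- The residual times that are compared with those of the stragglers.  If the original copies are
kept, all tasks count: a task that finishes before `q` has residual time `0` anyway.  If they
are killed, only the stragglers count, and their residual times do not involve `x`. -/
noncomputable def residual (pol : Policy) (q : ℝ) {n : ℕ} (m : ℕ) (x : Fin n → ℝ)
    (z : Fin n → Fin (pol.r + 1) → ℝ) (i : Fin n) : ℝ :=
  if pol.l = 1 ∨ IsStraggler m x i then residualTime pol q (x i) (z i) else 0

theorem abs_ciInf_sub_ciInf_le {k : ℕ} {f g : Fin (k + 1) → ℝ} {d : ℝ}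
    (h : ∀ j, |f j - g j| ≤ d) : |(⨅ j, f j) - ⨅ j, g j| ≤ d := by
  have hf : BddBelow (range f) := (finite_range f).bddBelow
  have hg : BddBelow (range g) := (finite_range g).bddBelow
  rw [abs_sub_le_iff]
  constructor
  · have : (⨅ j, f j) - d ≤ ⨅ j, g j := le_ciInf fun j => by
      have := ciInf_le hf j
      have := abs_le.1 (h j)
      linarith
    linarith
  · have : (⨅ j, g j) - d ≤ ⨅ j, f j := le_ciInf fun j => by
      have := ciInf_le hg j
      have := abs_le.1 (h j)
      linarith
    linarith

theorem residualTime_nonneg (pol : Policy) (q a : ℝ) {b : Fin (pol.r + 1) → ℝ}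
    (hb : ∀ j, 0 ≤ b j) : 0 ≤ residualTime pol q a b := by
  refine le_ciInf fun j => ?_
  split_ifs
  · exact le_max_right _ _
  · exact hb j

theorem residual_nonneg (pol : Policy) (q : ℝ) {n : ℕ} (m : ℕ) (x : Fin n → ℝ)
    {z : Fin n → Fin (pol.r + 1) → ℝ} (hz : ∀ i j, 0 ≤ z i j) (i : Fin n) :
    0 ≤ residual pol q m x z i := by
  unfold residual
  split_ifs
  · exact residualTime_nonneg pol q _ (hz i)
  · exact le_rfl

theorem l_eq_zero_or_one (pol : Policy) : pol.l = 0 ∨ pol.l = 1 := by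
  generalize pol.l = l
  fin_cases l <;> simp

theorem forkTime_le_taskFinish (pol : Policy) {n m : ℕ} (hmn : m < n) {x : Fin n → ℝ}
    {z : Fin n → Fin (pol.r + 1) → ℝ} (hz : ∀ i j, 0 ≤ z i j) {i : Fin n}
    (hi : IsStraggler m x i) : forkTime m x ≤ taskFinish pol m x z i := by
  rw [taskFinish, if_pos hi]
  refine le_ciInf fun j => ?_
  unfold replicaFinish
  split_ifs
  · exact forkTime_le_of_isStraggler hmn hi
  · linarith [hz i j]

theorem abs_taskFinish_sub_le (pol : Policy) (q : ℝ) {n m : ℕ} (hmn : m < n) {x : Fin n → ℝ}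
    (z : Fin n → Fin (pol.r + 1) → ℝ) {i : Fin n} (hi : IsStraggler m x i) :
    |taskFinish pol m x z i - forkTime m x - residual pol q m x z i| ≤ |forkTime m x - q| := by
  have hS := forkTime_le_of_isStraggler hmn hi
  rw [taskFinish, if_pos hi, residual, if_pos (Or.inr hi), residualTime]
  have h1 : (⨅ j, replicaFinish pol m x z i j) - forkTime m x =
      ⨅ j, (replicaFinish pol m x z i j - forkTime m x) :=
    (OrderIso.subRight (forkTime m x)).map_ciInf (finite_range _).bddBelow
  rw [h1]
  refine abs_ciInf_sub_ciInf_le fun j => ?_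
  unfold replicaFinish
  split_ifs
  · have h := abs_max_sub_max_le_abs (x i - forkTime m x) (x i - q) 0
    rw [max_eq_left (sub_nonneg.2 hS)] at h
    rwa [show x i - forkTime m x - (x i - q) = -(forkTime m x - q) by ring, abs_neg] at h
  · simp

theorem residual_le_of_not_isStraggler (pol : Policy) (q : ℝ) {n m : ℕ} (hmn : m < n)
    {x : Fin n → ℝ} (z : Fin n → Fin (pol.r + 1) → ℝ) {i : Fin n} (hi : ¬ IsStraggler m x i) :
    residual pol q m x z i ≤ |forkTime m x - q| := by
  have hS := le_forkTime_of_not_isStraggler hmn hi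
  unfold residual
  split_ifs with h
  · have hl : pol.l = 1 := h.resolve_right hi
    refine (ciInf_le (finite_range _).bddBelow 0).trans ?_
    rw [if_pos ⟨hl, rfl⟩]
    exact max_le ((sub_le_sub_right hS q).trans (le_abs_self _)) (abs_nonneg _)
  · exact abs_nonneg _

/-- The latency is within `2 |S - q|` of `q` plus the largest residual time, where `S` is the
forking point. -/
theorem abs_latency_sub_le (pol : Policy) (q : ℝ) {n m : ℕ} (hm : 0 < m) (hmn : m < n)
    {x : Fin n → ℝ} {z : Fin n → Fin (pol.r + 1) → ℝ} (hz : ∀ i j, 0 ≤ z i j) :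
    |latency pol m x z - (q + ⨆ i, residual pol q m x z i)| ≤ 2 * |forkTime m x - q| := by
  have : Nonempty (Fin n) := ⟨⟨0, by omega⟩⟩
  have hbT : BddAbove (range (taskFinish pol m x z)) := (finite_range _).bddAbove
  have hbU : BddAbove (range (residual pol q m x z)) := (finite_range _).bddAbove
  have hq := abs_le.1 (le_refl |forkTime m x - q|)
  obtain ⟨i₀, hi₀⟩ := exists_isStraggler hm hmn.le x
  have hST : forkTime m x ≤ latency pol m x z :=
    (forkTime_le_taskFinish pol hmn hz hi₀).trans (le_ciSup hbT i₀)
  rw [abs_sub_le_iff]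
  constructor
  · have : latency pol m x z ≤ q + (⨆ i, residual pol q m x z i) + 2 * |forkTime m x - q| := by
      refine ciSup_le fun i => ?_
      have hU := le_ciSup hbU i
      have hU0 := residual_nonneg pol q m x hz i
      by_cases hi : IsStraggler m x i
      · have := abs_le.1 (abs_taskFinish_sub_le pol q hmn z hi)
        linarith
      · have := le_forkTime_of_not_isStraggler hmn hi
        rw [taskFinish, if_neg hi]
        linarith
    linarith
  · have : (⨆ i, residual pol q m x z i) ≤ latency pol m x z - q + 2 * |forkTime m x - q| := by
      refine ciSup_le fun i => ?_
      by_cases hi : IsStraggler m x i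
      · have := abs_le.1 (abs_taskFinish_sub_le pol q hmn z hi)
        have := le_ciSup hbT i
        change _ ≤ latency pol m x z at this
        linarith
      · have := residual_le_of_not_isStraggler pol q hmn z hi
        linarith
    linarith

theorem taskRunningTime_of_isStraggler (pol : Policy) {n m : ℕ} {x : Fin n → ℝ}
    (z : Fin n → Fin (pol.r + 1) → ℝ) {i : Fin n} (hi : IsStraggler m x i) :
    taskRunningTime pol m x z i =
      forkTime m x + (pol.r + 1) * (taskFinish pol m x z i - forkTime m x) := by
  rw [taskRunningTime, if_pos hi]
  rcases l_eq_zero_or_one pol with hl | hl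
  · have h : ∀ j, ¬ IsOriginal pol j := fun j hj => by simpa [hl] using hj.1
    simp [hl, h]
    ring
  · have h : ∀ j, IsOriginal pol j ↔ j = 0 := fun j => by simp [IsOriginal, hl]
    simp only [h, Fin.sum_univ_succ, hl, Fin.succ_ne_zero, if_true, if_false]
    simp
    ring

/-- The machine time spent on a task is within `(r + 2) |S - q|` of its deterministic-fork
version: the original copy up to time `q`, plus `r + 1` machines for the residual time. -/
theorem abs_taskRunningTime_sub_le (pol : Policy) (q : ℝ) {n m : ℕ} (hmn : m < n)
    {x : Fin n → ℝ} {z : Fin n → Fin (pol.r + 1) → ℝ} (hz : ∀ i j, 0 ≤ z i j) (i : Fin n) :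
    |taskRunningTime pol m x z i - (min (x i) q + (pol.r + 1) * residual pol q m x z i)| ≤
      (pol.r + 2) * |forkTime m x - q| := by
  have hmin := abs_min_sub_min_le_max (x i) (forkTime m x) (x i) q
  rw [sub_self, abs_zero, max_eq_right (abs_nonneg _)] at hmin
  have hr : (0 : ℝ) ≤ pol.r + 1 := by positivity
  by_cases hi : IsStraggler m x i
  · rw [taskRunningTime_of_isStraggler pol z hi]
    rw [min_eq_right (forkTime_le_of_isStraggler hmn hi)] at hmin
    have h2 := mul_le_mul_of_nonneg_left (abs_taskFinish_sub_le pol q hmn z hi) hr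
    rw [← abs_of_nonneg hr, ← abs_mul, abs_of_nonneg hr] at h2
    have h3 := abs_add_le (forkTime m x - min (x i) q)
      ((pol.r + 1) * (taskFinish pol m x z i - forkTime m x - residual pol q m x z i))
    refine (le_of_eq ?_).trans (h3.trans ((add_le_add hmin h2).trans (le_of_eq (by ring))))
    congr 1
    ring
  · rw [taskRunningTime, if_neg hi]
    rw [min_eq_left (le_forkTime_of_not_isStraggler hmn hi)] at hmin
    have h0 := residual_nonneg pol q m x hz i
    have h2 := mul_le_mul_of_nonneg_left (residual_le_of_not_isStraggler pol q hmn z hi) hr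
    have h3 := mul_nonneg hr h0
    have := abs_le.1 hmin
    rw [abs_le]
    constructor <;> linarith [abs_nonneg (forkTime m x - q)]

theorem abs_cost_sub_le (pol : Policy) (q : ℝ) {n m : ℕ} (hmn : m < n)
    {x : Fin n → ℝ} {z : Fin n → Fin (pol.r + 1) → ℝ} (hz : ∀ i j, 0 ≤ z i j) :
    |cost pol m x z - 1 / (n : ℝ) * ∑ i, (min (x i) q + (pol.r + 1) * residual pol q m x z i)| ≤
      (pol.r + 2) * |forkTime m x - q| := by
  have hn : (0 : ℝ) < n := by exact_mod_cast (by omega : 0 < n)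
  rw [cost, ← mul_sub, ← Finset.sum_sub_distrib, abs_mul, abs_of_nonneg (by positivity)]
  have h := (Finset.abs_sum_le_sum_abs (fun i => taskRunningTime pol m x z i -
    (min (x i) q + (pol.r + 1) * residual pol q m x z i)) Finset.univ).trans
    (Finset.sum_le_sum fun i _ => abs_taskRunningTime_sub_le pol q hmn hz i)
  rw [Finset.sum_const, Finset.card_univ, Fintype.card_fin, nsmul_eq_mul] at h
  calc _ ≤ 1 / (n : ℝ) * (n * ((pol.r + 2) * |forkTime m x - q|)) :=
        mul_le_mul_of_nonneg_left h (by positivity)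
    _ = _ := by field_simp

/-! ### Measurability -/

theorem measurableSet_sort_eq {n : ℕ} (σ : Equiv.Perm (Fin n)) :
    MeasurableSet {x : Fin n → ℝ | Tuple.sort x = σ} := by
  have h : {x : Fin n → ℝ | Tuple.sort x = σ} =
      (⋂ i, ⋂ j, ⋂ _ : i ≤ j, {x | x (σ i) ≤ x (σ j)}) ∩
        ⋂ i, ⋂ j, ⋂ _ : i < j ∧ ¬ σ i < σ j, {x | x (σ i) = x (σ j)}ᶜ := by
    ext x
    simp only [mem_ofPred_eq, eq_comm (a := Tuple.sort x), Tuple.eq_sort_iff, mem_inter_iff,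
      mem_iInter, mem_compl_iff]
    refine and_congr ⟨fun h i j hij => h hij, fun h i j hij => h i j hij⟩ ?_
    exact ⟨fun h i j hij he => hij.2 (h i j hij.1 he), fun h i j hij he => by
      by_contra hc
      exact h i j ⟨hij, hc⟩ he⟩
  rw [h]
  refine MeasurableSet.inter ?_ ?_
  · exact MeasurableSet.iInter fun i => MeasurableSet.iInter fun j => MeasurableSet.iInter fun _ =>
      measurableSet_le (measurable_pi_apply _) (measurable_pi_apply _)
  · exact MeasurableSet.iInter fun i => MeasurableSet.iInter fun j => MeasurableSet.iInter fun _ =>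
      (measurableSet_eq_fun (measurable_pi_apply (σ i)) (measurable_pi_apply (σ j))).compl

theorem measurable_orderStat {n : ℕ} (k : ℕ) :
    Measurable fun x : Fin n → ℝ => orderStat x k := by
  classical
  unfold orderStat
  split_ifs with hk
  · have h : (fun x : Fin n → ℝ => x (Tuple.sort x ⟨k - 1, by omega⟩)) = fun x =>
        ∑ σ : Equiv.Perm (Fin n), if Tuple.sort x = σ then x (σ ⟨k - 1, by omega⟩) else 0 := by
      ext x
      simp
    rw [h]
    exact Finset.measurable_sum _ fun σ _ =>
      Measurable.ite (measurableSet_sort_eq σ) (measurable_pi_apply _) measurable_const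
  · exact measurable_const

theorem measurable_forkTime {n : ℕ} (m : ℕ) : Measurable fun x : Fin n → ℝ => forkTime m x :=
  measurable_orderStat _

theorem measurableSet_isStraggler {n : ℕ} (m : ℕ) (i : Fin n) :
    MeasurableSet {x : Fin n → ℝ | IsStraggler m x i} := by
  have h : {x : Fin n → ℝ | IsStraggler m x i} =
      ⋃ σ : Equiv.Perm (Fin n), ⋃ _ : n - m ≤ (σ.symm i : ℕ), {x | Tuple.sort x = σ} := by
    ext x
    simp [IsStraggler]
  rw [h]
  exact MeasurableSet.iUnion fun σ => MeasurableSet.iUnion fun _ => measurableSet_sort_eq σ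

theorem measurable_taskFinish (pol : Policy) {n : ℕ} (m : ℕ) (i : Fin n) :
    Measurable fun ω : (Fin n → ℝ) × (Fin n → Fin (pol.r + 1) → ℝ) =>
      taskFinish pol m ω.1 ω.2 i := by
  have hS : Measurable fun ω : (Fin n → ℝ) × (Fin n → Fin (pol.r + 1) → ℝ) => forkTime m ω.1 :=
    (measurable_forkTime m).comp measurable_fst
  refine Measurable.ite (measurable_fst (measurableSet_isStraggler m i)) ?_ (by fun_prop)
  refine Measurable.iInf fun j => ?_
  unfold replicaFinish
  split_ifs
  · fun_prop
  · exact hS.add (by fun_prop)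

theorem measurable_latency (pol : Policy) (n m : ℕ) :
    Measurable fun ω : (Fin n → ℝ) × (Fin n → Fin (pol.r + 1) → ℝ) => latency pol m ω.1 ω.2 :=
  Measurable.iSup fun i => measurable_taskFinish pol m i

theorem measurable_cost (pol : Policy) (n m : ℕ) :
    Measurable fun ω : (Fin n → ℝ) × (Fin n → Fin (pol.r + 1) → ℝ) => cost pol m ω.1 ω.2 := by
  have hS : Measurable fun ω : (Fin n → ℝ) × (Fin n → Fin (pol.r + 1) → ℝ) => forkTime m ω.1 :=
    (measurable_forkTime m).comp measurable_fst
  refine measurable_const.mul (Finset.measurable_sum _ fun i _ => ?_)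
  refine Measurable.ite (measurable_fst (measurableSet_isStraggler m i)) ?_ (by fun_prop)
  refine Measurable.add ?_ (Finset.measurable_sum _ fun j _ => ?_)
  · split_ifs
    · exact hS
    · exact measurable_const
  · refine (measurable_taskFinish pol m i).sub ?_
    split_ifs
    · exact measurable_const
    · exact hS

theorem measurable_residualTime (pol : Policy) (q : ℝ) :
    Measurable fun ab : ℝ × (Fin (pol.r + 1) → ℝ) => residualTime pol q ab.1 ab.2 := by
  refine Measurable.iInf fun j => ?_
  split_ifs <;> fun_prop

theorem measurable_residual (pol : Policy) (q : ℝ) {n : ℕ} (m : ℕ) (i : Fin n) :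
    Measurable fun ω : (Fin n → ℝ) × (Fin n → Fin (pol.r + 1) → ℝ) =>
      residual pol q m ω.1 ω.2 i := by
  refine Measurable.ite ?_ ?_ measurable_const
  · exact (MeasurableSet.const _).union (measurable_fst (measurableSet_isStraggler m i))
  · exact (measurable_residualTime pol q).comp
      (f := fun ω : (Fin n → ℝ) × (Fin n → Fin (pol.r + 1) → ℝ) => (ω.1 i, ω.2 i)) (by fun_prop)

instance isProbabilityMeasure_jobLaw (μ : Measure ℝ) [IsProbabilityMeasure μ] (pol : Policy)
    (n : ℕ) : IsProbabilityMeasure (jobLaw μ pol n) := by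
  unfold jobLaw
  infer_instance

theorem ae_jobLaw_nonneg {μ : Measure ℝ} [IsProbabilityMeasure μ] (hμ : ∀ᵐ x ∂μ, 0 ≤ x)
    (pol : Policy) (n : ℕ) : ∀ᵐ ω ∂(jobLaw μ pol n), ∀ i j, 0 ≤ ω.2 i j := by
  suffices h : ∀ᵐ z : Fin n → Fin (pol.r + 1) → ℝ ∂(Measure.pi fun _ => Measure.pi fun _ => μ),
      ∀ i j, 0 ≤ z i j by
    exact Measure.quasiMeasurePreserving_snd.ae h
  refine ae_all_iff.2 fun i => ae_all_iff.2 fun j => ?_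
  have h : ∀ᵐ b : Fin (pol.r + 1) → ℝ ∂(Measure.pi fun _ => μ), 0 ≤ b j :=
    Measure.tendsto_eval_ae_ae.eventually hμ
  exact (measurePreserving_eval (fun _ : Fin n => Measure.pi fun _ : Fin (pol.r + 1) => μ)
    i).quasiMeasurePreserving.ae h

/-! ### Tails of integrals -/

/-- A nonnegative random variable is integrable if its tail is bounded by an integrable
function. -/
theorem integrable_of_measureReal_lt_le {Ω : Type*} [MeasurableSpace Ω] {P : Measure Ω}
    [IsFiniteMeasure P] {f : Ω → ℝ} (hf : AEMeasurable f P) (hf0 : 0 ≤ᵐ[P] f) {g : ℝ → ℝ}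
    (hg : IntegrableOn g (Ioi 0)) (h : ∀ y, 0 < y → P.real {ω | y < f ω} ≤ g y) :
    Integrable f P := by
  refine ⟨hf.aestronglyMeasurable, ?_⟩
  rw [hasFiniteIntegral_iff_ofReal hf0, lintegral_eq_lintegral_meas_lt P hf0 hf]
  have h2 := (hasFiniteIntegral_iff_norm g).1 hg.2
  refine (lintegral_mono_ae ?_).trans_lt h2
  filter_upwards [ae_restrict_mem measurableSet_Ioi] with y hy
  rw [← ofReal_measureReal]
  exact ENNReal.ofReal_le_ofReal ((h y hy).trans (le_abs_self _))

theorem integrableOn_measureReal_lt {Ω : Type*} [MeasurableSpace Ω] {P : Measure Ω}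
    [IsFiniteMeasure P] {f : Ω → ℝ} (hf : Integrable f P) (hf0 : 0 ≤ᵐ[P] f) :
    IntegrableOn (fun y => P.real {ω | y < f ω}) (Ioi 0) := by
  have hanti : Antitone fun y => P.real {ω | y < f ω} := fun a b hab =>
    measureReal_mono fun ω hω => hab.trans_lt hω
  refine ⟨hanti.measurable.aestronglyMeasurable, ?_⟩
  have h := hf.2
  rw [hasFiniteIntegral_iff_ofReal hf0,
    lintegral_eq_lintegral_meas_lt P hf0 hf.aemeasurable] at h
  rw [hasFiniteIntegral_iff_ofReal (ae_of_all _ fun y => measureReal_nonneg)]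
  simpa using h

theorem integral_eq_of_measureReal_lt_eq {Ω : Type*} [MeasurableSpace Ω] {P : Measure Ω}
    [IsFiniteMeasure P] {f : Ω → ℝ} (hf : Integrable f P) (hf0 : 0 ≤ᵐ[P] f) {g : ℝ → ℝ}
    (h : ∀ y, 0 < y → P.real {ω | y < f ω} = g y) :
    ∫ ω, f ω ∂P = ∫ y in Ioi 0, g y := by
  rw [hf.integral_eq_integral_meas_lt hf0]
  exact setIntegral_congr_fun measurableSet_Ioi fun y hy => h y hy

/-! ### Counts of large and small execution times -/

theorem tail_eq_measureReal (μ : Measure ℝ) [IsProbabilityMeasure μ] (s : ℝ) :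
    tail μ s = μ.real (Ioi s) := by
  rw [tail, cdf_eq_real, ← compl_Iic, probReal_compl_eq_one_sub measurableSet_Iic]

/-- The factorial-moment bound for a binomial count `N`: by Markov's inequality for `N.choose j`,
`P(N ≥ k) ≤ n.choose j / k.choose j * P(A) ^ j`. -/
theorem choose_mul_measureReal_le_card {α : Type*} [MeasurableSpace α] (μ : Measure α)
    [IsProbabilityMeasure μ] {A : Set α} [DecidablePred (· ∈ A)] (hA : MeasurableSet A)
    (n k j : ℕ) :
    (k.choose j : ℝ) * (Measure.pi fun _ : Fin n => μ).real
      {x | k ≤ (Finset.univ.filter fun i => x i ∈ A).card} ≤ n.choose j * μ.real A ^ j := by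
  classical
  set P := Measure.pi fun _ : Fin n => μ
  have hB : ∀ B : Finset (Fin n), MeasurableSet {x : Fin n → α | ∀ i ∈ B, x i ∈ A} := fun B => by
    have : {x : Fin n → α | ∀ i ∈ B, x i ∈ A} = ⋂ i ∈ B, {x | x i ∈ A} := by ext; simp
    rw [this]
    exact Finset.measurableSet_biInter _ fun i _ => measurable_pi_apply i hA
  have hPB : ∀ B : Finset (Fin n), P.real {x : Fin n → α | ∀ i ∈ B, x i ∈ A} =
      μ.real A ^ B.card := fun B => by
    have : {x : Fin n → α | ∀ i ∈ B, x i ∈ A} =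
        Set.pi univ fun i => if i ∈ B then A else univ := by
      ext x
      simp only [mem_ofPred_eq, Set.mem_pi, mem_univ, true_imp_iff]
      refine forall_congr' fun i => ?_
      by_cases h : i ∈ B <;> simp [h]
    rw [this, measureReal_def, Measure.pi_pi, ENNReal.toReal_prod]
    simp only [apply_ite μ, measure_univ, apply_ite ENNReal.toReal, ENNReal.toReal_one]
    rw [Finset.prod_ite_mem, Finset.univ_inter, Finset.prod_const, measureReal_def]
  set E := {x : Fin n → α | k ≤ (Finset.univ.filter fun i => x i ∈ A).card}
  have hE : MeasurableSet E := by
    have : E = ⋃ B ∈ (Finset.univ : Finset (Finset (Fin n))).filter fun B => k ≤ B.card,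
        {x : Fin n → α | ∀ i ∈ B, x i ∈ A} := by
      ext x
      simp only [E, mem_ofPred_eq, mem_iUnion, Finset.mem_filter, Finset.mem_univ, true_and]
      constructor
      · intro h
        exact ⟨_, h, fun i hi => (Finset.mem_filter.1 hi).2⟩
      · rintro ⟨B, hB, h⟩
        exact hB.trans (Finset.card_le_card fun i hi => by simpa using h i hi)
    rw [this]
    exact Finset.measurableSet_biUnion _ fun B _ => hB B
  have hpt : ∀ x, E.indicator (fun _ => (k.choose j : ℝ)) x ≤
      ∑ B ∈ (Finset.univ : Finset (Fin n)).powersetCard j,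
        {x : Fin n → α | ∀ i ∈ B, x i ∈ A}.indicator (fun _ => (1 : ℝ)) x := by
    intro x
    by_cases hx : x ∈ E
    swap
    · rw [indicator_of_notMem hx]
      exact Finset.sum_nonneg fun B _ => indicator_nonneg (fun _ _ => zero_le_one) _
    rw [indicator_of_mem hx]
    have hx' : k ≤ (Finset.univ.filter fun i => x i ∈ A).card := hx
    have hsub : (Finset.univ.filter fun i => x i ∈ A).powersetCard j ⊆
        (Finset.univ : Finset (Fin n)).powersetCard j :=
      Finset.powersetCard_mono (Finset.subset_univ _)
    refine le_trans ?_ (Finset.sum_le_sum_of_subset_of_nonneg hsub fun B _ _ =>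
      indicator_nonneg (fun _ _ => zero_le_one) _)
    rw [Finset.sum_congr rfl fun B hB => indicator_of_mem (s := {x : Fin n → α | ∀ i ∈ B, x i ∈ A})
      (fun i hi => (Finset.mem_filter.1 ((Finset.mem_powersetCard.1 hB).1 hi)).2) _]
    rw [Finset.sum_const, Finset.card_powersetCard, nsmul_eq_mul, mul_one]
    exact_mod_cast Nat.choose_le_choose j hx'
  have hint : ∀ B ∈ (Finset.univ : Finset (Fin n)).powersetCard j,
      Integrable ({x : Fin n → α | ∀ i ∈ B, x i ∈ A}.indicator fun _ => (1 : ℝ)) P :=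
    fun B _ => (integrable_const _).indicator (hB B)
  have h := integral_mono ((integrable_const _).indicator hE) (integrable_finsetSum _ hint) hpt
  rw [integral_indicator_const _ hE, integral_finsetSum _ hint, smul_eq_mul, mul_comm] at h
  refine h.trans (le_of_eq ?_)
  rw [Finset.sum_congr rfl fun B hBm => by
    rw [integral_indicator_const _ (hB B), hPB B, (Finset.mem_powersetCard.1 hBm).2]]
  simp

/-- Chebyshev's inequality for a binomial count. -/
theorem measureReal_le_card_le {α : Type*} [MeasurableSpace α] (μ : Measure α)
    [IsProbabilityMeasure μ] {A : Set α} [DecidablePred (· ∈ A)] (hA : MeasurableSet A)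
    {n : ℕ} (hn : 0 < n) {δ : ℝ} (hδ : 0 < δ) :
    (Measure.pi fun _ : Fin n => μ).real
      {x | (μ.real A + δ) * n ≤ ((Finset.univ.filter fun i => x i ∈ A).card : ℝ)} ≤
      1 / δ ^ 2 / n := by
  set P := Measure.pi fun _ : Fin n => μ
  have hn' : (0 : ℝ) < n := by exact_mod_cast hn
  let f : α → ℝ := A.indicator fun _ => 1
  have hf : MemLp f 2 μ := (memLp_const 1).indicator hA
  have hX : MemLp (∑ i : Fin n, fun x : Fin n → α => f (x i)) 2 P :=
    memLp_finsetSum' _ fun i _ => hf.comp_measurePreserving (measurePreserving_eval _ i)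
  have hmean : ∫ x, (∑ i : Fin n, fun x : Fin n → α => f (x i)) x ∂P = n * μ.real A := by
    simp only [Finset.sum_apply]
    rw [integral_finsetSum _ fun i _ => integrable_comp_eval (hf.integrable one_le_two)]
    rw [Finset.sum_congr rfl fun i _ => integral_comp_eval hf.aestronglyMeasurable]
    simp [f, integral_indicator_const _ hA]
  have hvar : Var[∑ i : Fin n, fun x : Fin n → α => f (x i); P] ≤ n := by
    rw [variance_sum_pi fun _ => hf]
    have h1 : Var[f; μ] ≤ 1 := by
      refine (variance_le_expectation_sq hf.aestronglyMeasurable).trans ?_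
      have : ∀ x, (f ^ 2) x ≤ 1 := fun x => by
        by_cases hx : x ∈ A <;> simp [f, hx]
      calc ∫ x, (f ^ 2) x ∂μ ≤ ∫ _, (1 : ℝ) ∂μ :=
            integral_mono hf.integrable_sq (integrable_const _) this
        _ = 1 := by simp
    calc ∑ _i : Fin n, Var[f; μ] ≤ ∑ _i : Fin n, 1 := Finset.sum_le_sum fun _ _ => h1
      _ = n := by simp
  have hch := meas_ge_le_variance_div_sq hX (mul_pos hδ hn')
  rw [hmean] at hch
  have hsub : {x : Fin n → α |
      (μ.real A + δ) * n ≤ ((Finset.univ.filter fun i => x i ∈ A).card : ℝ)} ⊆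
      {x | δ * n ≤ |(∑ i : Fin n, fun x : Fin n → α => f (x i)) x - n * μ.real A|} := by
    intro x hx
    have hx' : (μ.real A + δ) * n ≤ ((Finset.univ.filter fun i => x i ∈ A).card : ℝ) := hx
    have hs : (∑ i : Fin n, fun x : Fin n → α => f (x i)) x =
        ((Finset.univ.filter fun i => x i ∈ A).card : ℝ) := by
      simp [f, Set.indicator_apply, Finset.sum_apply]
    rw [mem_ofPred_eq, hs]
    refine le_trans ?_ (le_abs_self _)
    linarith
  rw [measureReal_def]
  refine ENNReal.toReal_le_of_le_ofReal (by positivity)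
    ((measure_mono hsub).trans (hch.trans (ENNReal.ofReal_le_ofReal ?_)))
  calc _ ≤ (n : ℝ) / (δ * n) ^ 2 := by gcongr
    _ = _ := by field_simp

/-! ### Quantiles -/

theorem cdf_eq_zero_of_neg {μ : Measure ℝ} [IsProbabilityMeasure μ] (hμ : ∀ᵐ x ∂μ, 0 ≤ x)
    {x : ℝ} (hx : x < 0) : cdf μ x = 0 := by
  rw [cdf_eq_real, measureReal_eq_zero_iff]
  exact measure_mono_null (fun y hy => not_le.2 (lt_of_le_of_lt hy hx)) hμ

theorem nonneg_of_le_cdf {μ : Measure ℝ} [IsProbabilityMeasure μ] (hμ : ∀ᵐ x ∂μ, 0 ≤ x)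
    {h x : ℝ} (hh : 0 < h) (hx : h ≤ cdf μ x) : 0 ≤ x := by
  by_contra hc
  rw [cdf_eq_zero_of_neg hμ (not_le.1 hc)] at hx
  linarith

theorem quantile_nonneg {μ : Measure ℝ} [IsProbabilityMeasure μ] (hμ : ∀ᵐ x ∂μ, 0 ≤ x)
    {h : ℝ} (hh : 0 < h) : 0 ≤ quantile μ h :=
  Real.sInf_nonneg fun _ hx => nonneg_of_le_cdf hμ hh hx

theorem quantile_le_iff {μ : Measure ℝ} [IsProbabilityMeasure μ] (hμ : ∀ᵐ x ∂μ, 0 ≤ x)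
    {h : ℝ} (h0 : 0 < h) (h1 : h < 1) (x : ℝ) : quantile μ h ≤ x ↔ h ≤ cdf μ x := by
  constructor
  · intro hx
    have h2 := tail_quantile_le μ (sub_pos.2 h1)
    rw [sub_sub_cancel, tail] at h2
    linarith [monotone_cdf μ hx]
  · intro hx
    exact csInf_le ⟨0, fun y hy => nonneg_of_le_cdf hμ h0 hy⟩ hx

/-! ### The law of the residual straggler time -/

theorem tendsto_tail_atTop (μ : Measure ℝ) : Tendsto (tail μ) atTop (𝓝 0) := by
  have h := (tendsto_cdf_atTop μ).const_sub 1
  rwa [sub_self] at h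

theorem tendsto_residualTail_atTop (μ : Measure ℝ) (pol : Policy) :
    Tendsto (residualTail μ pol) atTop (𝓝 0) := by
  have h1 := tendsto_tail_atTop μ
  unfold residualTail
  split_ifs
  · simpa using h1.pow (pol.r + 1)
  · have h2 := h1.comp (tendsto_atTop_add_const_right _ (quantile μ (1 - pol.p)) tendsto_id)
    simpa using ((h1.pow pol.r).const_mul (1 / pol.p)).mul h2

theorem residualCDF_of_neg (μ : Measure ℝ) (pol : Policy) {y : ℝ} (hy : y < 0) :
    residualCDF μ pol y = 0 := if_pos hy

theorem residualCDF_of_nonneg (μ : Measure ℝ) (pol : Policy) {y : ℝ} (hy : 0 ≤ y) :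
    residualCDF μ pol y = 1 - residualTail μ pol y := if_neg (not_lt.2 hy)

theorem tendsto_residualCDF_atTop (μ : Measure ℝ) (pol : Policy) :
    Tendsto (residualCDF μ pol) atTop (𝓝 1) := by
  have h := (tendsto_residualTail_atTop μ pol).const_sub 1
  rw [sub_zero] at h
  refine h.congr' ?_
  filter_upwards [eventually_ge_atTop 0] with y hy
  exact (residualCDF_of_nonneg μ pol hy).symm

theorem tendsto_residualCDF_atBot (μ : Measure ℝ) (pol : Policy) :
    Tendsto (residualCDF μ pol) atBot (𝓝 0) := by
  refine tendsto_const_nhds.congr' ?_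
  filter_upwards [eventually_lt_atBot 0] with y hy
  exact (residualCDF_of_neg μ pol hy).symm

instance isProbabilityMeasure_residualLaw (μ : Measure ℝ) (pol : Policy) :
    IsProbabilityMeasure (residualLaw μ pol) :=
  (residualCDF μ pol).isProbabilityMeasure (tendsto_residualCDF_atBot μ pol)
    (tendsto_residualCDF_atTop μ pol)

theorem residualLaw_real_Ioi (μ : Measure ℝ) (pol : Policy) {y : ℝ} (hy : 0 ≤ y) :
    (residualLaw μ pol).real (Ioi y) = residualTail μ pol y := by
  rw [measureReal_def, residualLaw,
    StieltjesFunction.measure_Ioi _ (tendsto_residualCDF_atTop μ pol),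
    residualCDF_of_nonneg μ pol hy, sub_sub_cancel,
    ENNReal.toReal_ofReal (residualTail_nonneg μ pol y)]

theorem ae_residualLaw_nonneg (μ : Measure ℝ) (pol : Policy) :
    ∀ᵐ y ∂(residualLaw μ pol), 0 ≤ y := by
  have h : Tendsto (residualCDF μ pol) (𝓝[<] 0) (𝓝 0) := by
    refine tendsto_const_nhds.congr' ?_
    filter_upwards [self_mem_nhdsWithin] with y hy
    exact (residualCDF_of_neg μ pol hy).symm
  have h2 : residualLaw μ pol (Iio 0) = 0 := by
    rw [residualLaw, StieltjesFunction.measure_Iio _ (tendsto_residualCDF_atBot μ pol),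
      leftLim_eq_of_tendsto h]
    simp
  refine measure_mono_null (fun y hy => ?_) h2
  simpa using hy

theorem integrableOn_residualTail {μ : Measure ℝ} {pol : Policy}
    (hY : Integrable (fun y : ℝ => y) (residualLaw μ pol)) :
    IntegrableOn (residualTail μ pol) (Ioi 0) :=
  (integrableOn_measureReal_lt hY (ae_residualLaw_nonneg μ pol)).congr_fun
    (fun _ hy => residualLaw_real_Ioi μ pol (le_of_lt hy)) measurableSet_Ioi

theorem expectedResidual_eq {μ : Measure ℝ} {pol : Policy}
    (hY : Integrable (fun y : ℝ => y) (residualLaw μ pol)) :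
    expectedResidual μ pol = ∫ y in Ioi 0, residualTail μ pol y :=
  integral_eq_of_measureReal_lt_eq hY (ae_residualLaw_nonneg μ pol) fun _ hy =>
    residualLaw_real_Ioi μ pol hy.le

/-! ### Convergence of the forking point -/

theorem tail_pow_le_residualTail {μ : Measure ℝ} [IsProbabilityMeasure μ]
    (hμ : ∀ᵐ x ∂μ, 0 ≤ x) (pol : Policy) (y : ℝ) :
    tail μ (y + quantile μ (1 - pol.p)) ^ (pol.r + 1) ≤ residualTail μ pol y := by
  have hp := pol.p_pos
  have hp1 := pol.p_lt_one
  have hq : 0 ≤ quantile μ (1 - pol.p) := quantile_nonneg hμ (by linarith)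
  have h1 := tail_nonneg μ (y + quantile μ (1 - pol.p))
  have h2 : tail μ (y + quantile μ (1 - pol.p)) ≤ tail μ y := tail_antitone μ (by linarith)
  unfold residualTail
  split_ifs
  · gcongr
  · have h3 : (1 : ℝ) ≤ 1 / pol.p := by
      rw [le_div_iff₀ hp]
      linarith
    have h4 : 0 ≤ tail μ y := tail_nonneg μ y
    calc tail μ (y + quantile μ (1 - pol.p)) ^ (pol.r + 1)
        = 1 * tail μ (y + quantile μ (1 - pol.p)) ^ pol.r *
          tail μ (y + quantile μ (1 - pol.p)) := by ring
      _ ≤ _ := by gcongr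

/-- At least `m + 1` of the `n` execution times exceed `s` if the forking point does.  As
`m / n` is bounded below, the factorial moment of order `r + 1` gives a bound that is uniform
in `n`. -/
theorem measureReal_lt_forkTime_le (μ : Measure ℝ) [IsProbabilityMeasure μ] {p : ℝ} (hp : 0 < p)
    {n m r : ℕ} (hmn : m < n) (hm : p * n < m + 1) (hr : 2 * (r : ℝ) ≤ p * n) (s : ℝ) :
    (Measure.pi fun _ : Fin n => μ).real {x | s < forkTime m x} ≤
      (2 / p) ^ (r + 1) * tail μ s ^ (r + 1) := by
  classical
  have hn : (0 : ℝ) < n := by exact_mod_cast (by omega : 0 < n)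
  have hsub : {x : Fin n → ℝ | s < forkTime m x} ⊆
      {x | m + 1 ≤ (Finset.univ.filter fun i => x i ∈ Ioi s).card} := by
    intro x hx
    have h := lt_card_of_lt_orderStat x (by omega : 0 < n - m) (by omega) hx
    have h2 : m < (Finset.univ.filter fun i => s < x i).card := by omega
    simpa using h2
  have hP := measureReal_mono (μ := Measure.pi fun _ : Fin n => μ) hsub
  have hch := choose_mul_measureReal_le_card μ (measurableSet_Ioi (a := s)) n (m + 1) (r + 1)
  rw [← tail_eq_measureReal] at hch
  set Q := (Measure.pi fun _ : Fin n => μ).real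
    {x | m + 1 ≤ (Finset.univ.filter fun i => x i ∈ Ioi s).card}
  have ht := tail_nonneg μ s
  have hQ0 : 0 ≤ Q := measureReal_nonneg
  have hfac : (0 : ℝ) < (r + 1).factorial := by exact_mod_cast Nat.factorial_pos _
  have hrm : r ≤ m + 1 := by
    have h0 := Nat.cast_nonneg (α := ℝ) r
    have : (r : ℝ) ≤ m + 1 := by linarith
    exact_mod_cast this
  have hlow : (p * n / 2) ^ (r + 1) / (r + 1).factorial ≤ ((m + 1).choose (r + 1) : ℝ) := by
    refine le_trans ?_ (Nat.pow_le_choose (r + 1) (m + 1))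
    have hcast : ((m + 1 + 1 - (r + 1) : ℕ) : ℝ) = m + 1 - r := by
      rw [Nat.add_sub_add_right, Nat.cast_sub hrm]
      push_cast
      ring
    rw [hcast]
    gcongr
    linarith
  have hup := Nat.choose_le_pow_div (α := ℝ) (r + 1) n
  have hkey : (p * n / 2) ^ (r + 1) / (r + 1).factorial * Q ≤
      n ^ (r + 1) / (r + 1).factorial * tail μ s ^ (r + 1) :=
    (mul_le_mul_of_nonneg_right hlow hQ0).trans (hch.trans
      (mul_le_mul_of_nonneg_right hup (by positivity)))
  refine hP.trans ?_
  have hc : (0 : ℝ) < (p * n / 2) ^ (r + 1) / (r + 1).factorial := by positivity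
  refine le_of_mul_le_mul_left (hkey.trans (le_of_eq ?_)) hc
  have : (p * n / 2) ^ (r + 1) * (2 / p) ^ (r + 1) = (n : ℝ) ^ (r + 1) := by
    rw [← mul_pow]
    congr 1
    field_simp
  rw [← this]
  ring

theorem measureReal_forkTime_le_eq_zero {μ : Measure ℝ} [IsProbabilityMeasure μ]
    (hμ : ∀ᵐ x ∂μ, 0 ≤ x) {n m : ℕ} (hmn : m < n) {s : ℝ} (hs : s < 0) :
    (Measure.pi fun _ : Fin n => μ).real {x | forkTime m x ≤ s} = 0 := by
  classical
  refine le_antisymm ?_ measureReal_nonneg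
  have hsub : {x : Fin n → ℝ | forkTime m x ≤ s} ⊆
      {x | 1 ≤ (Finset.univ.filter fun i => x i ∈ Iic s).card} := by
    intro x hx
    have h := le_card_of_orderStat_le x (by omega : 0 < n - m) (by omega) hx
    have h2 : 1 ≤ (Finset.univ.filter fun i => x i ≤ s).card := by omega
    simpa using h2
  refine (measureReal_mono hsub).trans ?_
  -- the union bound: the case `k = j = 1` of the factorial-moment bound
  have hch := choose_mul_measureReal_le_card μ (measurableSet_Iic (a := s)) n 1 1
  rw [← cdf_eq_real, cdf_eq_zero_of_neg hμ hs] at hch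
  simpa using hch

theorem eventually_straggler_bounds (pol : Policy) {m : ℕ → ℕ}
    (hm : ∀ n : ℕ, |(m n : ℝ) - pol.p * n| < 1) :
    ∀ᶠ n : ℕ in atTop, 0 < m n ∧ m n < n ∧ 2 * (pol.r : ℝ) ≤ pol.p * n := by
  have hp := pol.p_pos
  have hp1 := pol.p_lt_one
  have h1 := (tendsto_natCast_atTop_atTop (R := ℝ)).const_mul_atTop hp
  have h2 := (tendsto_natCast_atTop_atTop (R := ℝ)).const_mul_atTop (sub_pos.2 hp1)
  filter_upwards [h1.eventually_ge_atTop 1, h1.eventually_ge_atTop (2 * pol.r),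
    h2.eventually_ge_atTop 1] with n ha hb hc
  have hmn := abs_lt.1 (hm n)
  refine ⟨?_, ?_, hb⟩
  · have : (0 : ℝ) < m n := by linarith
    exact_mod_cast this
  · have : (m n : ℝ) < n := by linarith
    exact_mod_cast this

theorem tendsto_measureReal_lt_forkTime (μ : Measure ℝ) [IsProbabilityMeasure μ] (pol : Policy)
    {m : ℕ → ℕ} (hm : ∀ n : ℕ, |(m n : ℝ) - pol.p * n| < 1) {s : ℝ} (hs : tail μ s < pol.p) :
    Tendsto (fun n => (Measure.pi fun _ : Fin n => μ).real {x | s < forkTime (m n) x})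
      atTop (𝓝 0) := by
  classical
  have hlim := tendsto_const_div_atTop_nhds_zero_nat (1 / (pol.p - tail μ s) ^ 2)
  refine squeeze_zero' (Eventually.of_forall fun _ => measureReal_nonneg) ?_ hlim
  filter_upwards [eventually_straggler_bounds pol hm] with n hn
  refine (measureReal_mono ?_).trans
    (measureReal_le_card_le μ (measurableSet_Ioi (a := s)) (by omega) (sub_pos.2 hs))
  intro x hx
  rw [mem_ofPred_eq, ← tail_eq_measureReal]
  have h := lt_card_of_lt_orderStat x (by omega : 0 < n - m n) (by omega) hx
  have h2 : m n + 1 ≤ (Finset.univ.filter fun i => s < x i).card := by omega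
  have h3 : (m n : ℝ) + 1 ≤ ((Finset.univ.filter fun i => s < x i).card : ℝ) := by
    exact_mod_cast h2
  have := abs_lt.1 (hm n)
  simp only [mem_Ioi]
  linarith

theorem tendsto_measureReal_forkTime_le (μ : Measure ℝ) [IsProbabilityMeasure μ] (pol : Policy)
    {m : ℕ → ℕ} (hm : ∀ n : ℕ, |(m n : ℝ) - pol.p * n| < 1) {s : ℝ} (hs : cdf μ s < 1 - pol.p) :
    Tendsto (fun n => (Measure.pi fun _ : Fin n => μ).real {x | forkTime (m n) x ≤ s})
      atTop (𝓝 0) := by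
  classical
  have hδ : 0 < (1 - pol.p - cdf μ s) / 2 := by linarith
  have hlim := tendsto_const_div_atTop_nhds_zero_nat (1 / ((1 - pol.p - cdf μ s) / 2) ^ 2)
  have h1 := (tendsto_natCast_atTop_atTop (R := ℝ)).const_mul_atTop hδ
  refine squeeze_zero' (Eventually.of_forall fun _ => measureReal_nonneg) ?_ hlim
  filter_upwards [eventually_straggler_bounds pol hm, h1.eventually_ge_atTop 1] with n hn hn1
  refine (measureReal_mono ?_).trans
    (measureReal_le_card_le μ (measurableSet_Iic (a := s)) (by omega) hδ)
  intro x hx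
  rw [mem_ofPred_eq, ← cdf_eq_real]
  have h := le_card_of_orderStat_le x (by omega : 0 < n - m n) (by omega) hx
  have h2 : n ≤ (Finset.univ.filter fun i => x i ≤ s).card + m n := by omega
  have h3 : (n : ℝ) ≤ ((Finset.univ.filter fun i => x i ≤ s).card : ℝ) + m n := by
    exact_mod_cast h2
  have := abs_lt.1 (hm n)
  simp only [mem_Iic]
  linarith

/-- The forking point converges to the quantile `F_X⁻¹(1 - p)` in `L¹`. -/
theorem tendsto_integral_abs_forkTime_sub {μ : Measure ℝ} [IsProbabilityMeasure μ]
    (hμ : ∀ᵐ x ∂μ, 0 ≤ x) (pol : Policy)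
    (hq : ∀ y : ℝ, quantile μ (1 - pol.p) < y → 1 - pol.p < cdf μ y)
    (hY : Integrable (fun y : ℝ => y) (residualLaw μ pol))
    {m : ℕ → ℕ} (hm : ∀ n : ℕ, |(m n : ℝ) - pol.p * n| < 1) :
    (∀ᶠ n : ℕ in atTop, Integrable (fun x : Fin n → ℝ =>
      |forkTime (m n) x - quantile μ (1 - pol.p)|) (Measure.pi fun _ => μ)) ∧
    Tendsto (fun n : ℕ => ∫ x : Fin n → ℝ, |forkTime (m n) x - quantile μ (1 - pol.p)|
      ∂(Measure.pi fun _ => μ)) atTop (𝓝 0) := by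
  have hp := pol.p_pos
  have hp1 := pol.p_lt_one
  set q := quantile μ (1 - pol.p)
  let P : ∀ n : ℕ, Measure (Fin n → ℝ) := fun n => Measure.pi fun _ => μ
  let D : ∀ n : ℕ, (Fin n → ℝ) → ℝ := fun n x => |forkTime (m n) x - q|
  have hDm : ∀ n, Measurable (D n) := fun n => ((measurable_forkTime (m n)).sub_const q).abs
  have hD0 : ∀ n, 0 ≤ᵐ[P n] D n := fun n => ae_of_all _ fun _ => abs_nonneg _
  have hsplit : ∀ n y, (P n).real {x | y < D n x} ≤
      (P n).real {x | y + q < forkTime (m n) x} + (P n).real {x | forkTime (m n) x ≤ q - y} := by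
    intro n y
    refine (measureReal_mono fun x hx => ?_).trans (measureReal_union_le _ _)
    have hx' : y < |forkTime (m n) x - q| := hx
    rcases lt_abs.1 hx' with h | h
    · exact Or.inl (show y + q < forkTime (m n) x by linarith)
    · exact Or.inr (show forkTime (m n) x ≤ q - y by linarith)
  let g : ℝ → ℝ := fun y =>
    (2 / pol.p) ^ (pol.r + 1) * residualTail μ pol y + (Iic q).indicator (fun _ => 1) y
  have hg : IntegrableOn g (Ioi 0) := by
    refine ((integrableOn_residualTail hY).const_mul _).add ?_
    rw [integrable_indicator_iff measurableSet_Iic, IntegrableOn,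
      Measure.restrict_restrict measurableSet_Iic, inter_comm, Ioi_inter_Iic]
    exact integrableOn_const (by simp)
  have hbound : ∀ᶠ n in atTop, ∀ y, 0 < y → (P n).real {x | y < D n x} ≤ g y := by
    filter_upwards [eventually_straggler_bounds pol hm] with n hn y hy
    have hmn := abs_lt.1 (hm n)
    refine (hsplit n y).trans (add_le_add ?_ ?_)
    · refine (measureReal_lt_forkTime_le μ hp hn.2.1 (by linarith) hn.2.2 (y + q)).trans ?_
      exact mul_le_mul_of_nonneg_left (tail_pow_le_residualTail hμ pol y) (by positivity)
    · by_cases hyq : y ≤ q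
      · rw [indicator_of_mem (mem_Iic.2 hyq)]
        exact measureReal_le_one
      · rw [indicator_of_notMem (by simpa using hyq)]
        exact (measureReal_forkTime_le_eq_zero hμ hn.2.1 (by linarith)).le
  have hint : ∀ᶠ n in atTop, Integrable (D n) (P n) := by
    filter_upwards [hbound] with n hn
    exact integrable_of_measureReal_lt_le (hDm n).aemeasurable (hD0 n) hg hn
  refine ⟨hint, ?_⟩
  have hpt : ∀ y, 0 < y → Tendsto (fun n => (P n).real {x | y < D n x}) atTop (𝓝 0) := by
    intro y hy
    have h1 : tail μ (y + q) < pol.p := by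
      have := hq (y + q) (by linarith)
      unfold tail
      linarith
    have h2 : cdf μ (q - y) < 1 - pol.p := by
      rw [← not_le, ← quantile_le_iff hμ (by linarith) (by linarith), not_le]
      linarith
    have h3 := (tendsto_measureReal_lt_forkTime μ pol hm h1).add
      (tendsto_measureReal_forkTime_le μ pol hm h2)
    rw [add_zero] at h3
    exact squeeze_zero (fun _ => measureReal_nonneg) (fun n => hsplit n y) h3
  have hdct := tendsto_integral_filter_of_dominated_convergence
    (μ := volume.restrict (Ioi (0 : ℝ))) (l := atTop)
    (F := fun n y => (P n).real {x | y < D n x}) (f := fun _ => 0) g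
    (by
      refine Eventually.of_forall fun n => Measurable.aestronglyMeasurable ?_
      exact Antitone.measurable fun a b hab => measureReal_mono fun x hx => hab.trans_lt hx)
    (by
      filter_upwards [hbound] with n hn
      filter_upwards [ae_restrict_mem measurableSet_Ioi] with y hy
      rw [Real.norm_of_nonneg measureReal_nonneg]
      exact hn y hy)
    hg
    (by
      filter_upwards [ae_restrict_mem measurableSet_Ioi] with y hy
      exact hpt y hy)
  rw [integral_zero] at hdct
  refine hdct.congr' ?_
  filter_upwards [hint] with n hn
  exact (hn.integral_eq_integral_meas_lt (hD0 n)).symm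

/-! ### The law of the residual times -/

theorem lt_residualTime_iff (pol : Policy) (q a : ℝ) (b : Fin (pol.r + 1) → ℝ) {y : ℝ} :
    y < residualTime pol q a b ↔
      ∀ j, (IsOriginal pol j → y < max (a - q) 0) ∧ (¬ IsOriginal pol j → y < b j) := by
  classical
  have h : y < residualTime pol q a b ↔
      ∀ j, y < if IsOriginal pol j then max (a - q) 0 else b j := by
    constructor
    · exact fun h j => h.trans_le (ciInf_le (finite_range _).bddBelow j)
    · intro h
      obtain ⟨j, hj⟩ := exists_eq_ciInf_of_finite
        (f := fun j => if IsOriginal pol j then max (a - q) 0 else b j)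
      exact (h j).trans_eq hj
  rw [h]
  refine forall_congr' fun j => ?_
  by_cases hj : IsOriginal pol j <;> simp [hj]

theorem measureReal_lt_residualTime_of_l_eq_zero (μ : Measure ℝ) [IsProbabilityMeasure μ]
    {pol : Policy} (hl : pol.l = 0) (q a y : ℝ) :
    (Measure.pi fun _ : Fin (pol.r + 1) => μ).real {b | y < residualTime pol q a b} =
      residualTail μ pol y := by
  have h : {b | y < residualTime pol q a b} =
      Set.pi univ fun _ : Fin (pol.r + 1) => Ioi y := by
    ext b
    simp [lt_residualTime_iff, IsOriginal, hl]
  rw [h, measureReal_def, Measure.pi_pi, ENNReal.toReal_prod, residualTail, if_pos hl,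
    tail_eq_measureReal]
  simp [measureReal_def]

theorem measureReal_lt_residualTime_of_l_eq_one (μ : Measure ℝ) [IsProbabilityMeasure μ]
    {pol : Policy} (hl : pol.l = 1) {y : ℝ} (hy : 0 ≤ y) :
    (μ.prod (Measure.pi fun _ : Fin (pol.r + 1) => μ)).real
      {ab | y < residualTime pol (quantile μ (1 - pol.p)) ab.1 ab.2} =
      pol.p * residualTail μ pol y := by
  have hp := pol.p_pos
  set q := quantile μ (1 - pol.p)
  have h : {ab : ℝ × (Fin (pol.r + 1) → ℝ) | y < residualTime pol q ab.1 ab.2} =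
      Ioi (y + q) ×ˢ Set.pi univ fun j : Fin (pol.r + 1) => if j = 0 then univ else Ioi y := by
    ext ⟨a, b⟩
    simp only [mem_ofPred_eq, lt_residualTime_iff, IsOriginal, hl, true_and, mem_prod, mem_Ioi,
      Set.mem_pi, mem_univ, true_imp_iff]
    constructor
    · intro h
      refine ⟨?_, fun j => ?_⟩
      · rcases lt_max_iff.1 ((h 0).1 rfl) with h0 | h0 <;> linarith
      · by_cases hj : j = 0
        · simp [hj]
        · simpa [hj] using (h j).2 hj
    · rintro ⟨h1, h2⟩ j
      refine ⟨fun _ => lt_max_of_lt_left (by linarith), fun hj => ?_⟩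
      simpa [hj] using h2 j
  have hl0 : pol.l ≠ 0 := by simp [hl]
  rw [h, measureReal_prod_prod, ← tail_eq_measureReal, measureReal_def, Measure.pi_pi,
    ENNReal.toReal_prod, residualTail, if_neg hl0, Fin.prod_univ_succ, tail_eq_measureReal μ y]
  simp only [if_true, Fin.succ_ne_zero, if_false, measure_univ, ENNReal.toReal_one,
    Finset.prod_const, Finset.card_univ, Fintype.card_fin, measureReal_def]
  field_simp
  ring

theorem measurePreserving_task (μ : Measure ℝ) [IsProbabilityMeasure μ] (pol : Policy) {n : ℕ}
    (i : Fin n) : MeasurePreserving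
      (fun ω : (Fin n → ℝ) × (Fin n → Fin (pol.r + 1) → ℝ) => (ω.1 i, ω.2 i))
      (jobLaw μ pol n) (μ.prod (Measure.pi fun _ => μ)) :=
  (measurePreserving_eval (fun _ : Fin n => μ) i).prod
    (measurePreserving_eval (fun _ : Fin n => Measure.pi fun _ : Fin (pol.r + 1) => μ) i)

theorem measureReal_le_compl {Ω : Type*} [MeasurableSpace Ω] (P : Measure Ω)
    [IsProbabilityMeasure P] {f : Ω → ℝ} (hf : Measurable f) (y : ℝ) :
    P.real {ω | f ω ≤ y} = 1 - P.real {ω | y < f ω} := by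
  rw [← probReal_compl_eq_one_sub (measurableSet_lt measurable_const hf)]
  congr 1
  ext ω
  simp

/-- If the original copies are killed, then, whatever the stragglers are, the `m` residual times
that count are i.i.d. with tail `residualTail`. -/
theorem measureReal_forall_residual_le_of_l_eq_zero (μ : Measure ℝ) [IsProbabilityMeasure μ]
    {pol : Policy} (hl : pol.l = 0) (q : ℝ) {n m : ℕ} (hmn : m ≤ n) {y : ℝ} (hy : 0 ≤ y) :
    (jobLaw μ pol n).real {ω | ∀ i, residual pol q m ω.1 ω.2 i ≤ y} =
      (1 - residualTail μ pol y) ^ m := by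
  classical
  have hmeas : MeasurableSet {ω : (Fin n → ℝ) × (Fin n → Fin (pol.r + 1) → ℝ) |
      ∀ i, residual pol q m ω.1 ω.2 i ≤ y} := by
    simp only [ofPred_forall]
    exact MeasurableSet.iInter fun i =>
      measurableSet_le (measurable_residual pol q m i) measurable_const
  have hl1 : ¬ pol.l = 1 := by simp [hl]
  have hsec : ∀ x : Fin n → ℝ, (Measure.pi fun _ : Fin n =>
      Measure.pi fun _ : Fin (pol.r + 1) => μ)
      (Prod.mk x ⁻¹' {ω | ∀ i, residual pol q m ω.1 ω.2 i ≤ y}) =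
      ENNReal.ofReal ((1 - residualTail μ pol y) ^ m) := by
    intro x
    have h : Prod.mk x ⁻¹' {ω : (Fin n → ℝ) × (Fin n → Fin (pol.r + 1) → ℝ) |
        ∀ i, residual pol q m ω.1 ω.2 i ≤ y} = Set.pi univ fun i =>
          if IsStraggler m x i then {b | residualTime pol q (x i) b ≤ y} else univ := by
      ext z
      simp only [mem_preimage, mem_ofPred_eq, Set.mem_pi, mem_univ, true_imp_iff]
      refine forall_congr' fun i => ?_
      by_cases hi : IsStraggler m x i <;> simp [residual, hi, hl1, hy]
    have hone : ∀ i, (Measure.pi fun _ : Fin (pol.r + 1) => μ)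
        {b | residualTime pol q (x i) b ≤ y} = ENNReal.ofReal (1 - residualTail μ pol y) := by
      intro i
      have hm : Measurable fun b => residualTime pol q (x i) b :=
        (measurable_residualTime pol q).comp measurable_prodMk_left
      rw [← ofReal_measureReal, measureReal_le_compl _ hm,
        measureReal_lt_residualTime_of_l_eq_zero μ hl]
    rw [h, Measure.pi_pi]
    simp only [apply_ite (Measure.pi fun _ : Fin (pol.r + 1) => μ), hone, measure_univ]
    rw [← Finset.prod_filter, Finset.prod_const, card_isStraggler hmn,
      ENNReal.ofReal_pow (sub_nonneg.2 (residualTail_le_one μ pol hy))]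
  rw [measureReal_def, jobLaw, Measure.prod_apply hmeas, lintegral_congr hsec, lintegral_const,
    measure_univ, mul_one, ENNReal.toReal_ofReal]
  exact pow_nonneg (sub_nonneg.2 (residualTail_le_one μ pol hy)) _

theorem measureReal_forall_residual_le_of_l_eq_one (μ : Measure ℝ) [IsProbabilityMeasure μ]
    {pol : Policy} (hl : pol.l = 1) (n m : ℕ) {y : ℝ} (hy : 0 ≤ y) :
    (jobLaw μ pol n).real {ω | ∀ i, residual pol (quantile μ (1 - pol.p)) m ω.1 ω.2 i ≤ y} =
      (1 - pol.p * residualTail μ pol y) ^ n := by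
  set q := quantile μ (1 - pol.p)
  have hmp := measurePreserving_arrowProdEquivProdArrow ℝ (Fin (pol.r + 1) → ℝ) (Fin n)
    (fun _ => μ) (fun _ => Measure.pi fun _ => μ)
  have hmeas : MeasurableSet {ω : (Fin n → ℝ) × (Fin n → Fin (pol.r + 1) → ℝ) |
      ∀ i, residual pol q m ω.1 ω.2 i ≤ y} := by
    simp only [ofPred_forall]
    exact MeasurableSet.iInter fun i =>
      measurableSet_le (measurable_residual pol q m i) measurable_const
  rw [jobLaw, ← hmp.measureReal_preimage hmeas.nullMeasurableSet]
  have h : MeasurableEquiv.arrowProdEquivProdArrow ℝ (Fin (pol.r + 1) → ℝ) (Fin n) ⁻¹'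
      {ω | ∀ i, residual pol q m ω.1 ω.2 i ≤ y} =
      Set.pi univ fun _ => {ab | residualTime pol q ab.1 ab.2 ≤ y} := by
    ext w
    simp only [mem_preimage, mem_ofPred_eq, Set.mem_pi, mem_univ, true_imp_iff, residual, hl,
      true_or, if_true]
    rfl
  rw [h, measureReal_def, Measure.pi_pi, ENNReal.toReal_prod]
  simp only [← measureReal_def, measureReal_le_compl _ (measurable_residualTime pol q),
    measureReal_lt_residualTime_of_l_eq_one μ hl hy, Finset.prod_const, Finset.card_univ,
    Fintype.card_fin, q]

/-! ### Expectations of maxima and sums of residual times -/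

theorem lt_ciSup_fin_iff {n : ℕ} (f : Fin n → ℝ) {y : ℝ} (hy : 0 ≤ y) :
    y < (⨆ i, f i) ↔ ¬ ∀ i, f i ≤ y := by
  rw [← not_le, not_iff_not]
  exact ⟨fun h i => (le_ciSup (finite_range f).bddAbove i).trans h, fun h => Real.iSup_le h hy⟩

theorem integrable_iSup_and_integral_eq {Ω : Type*} [MeasurableSpace Ω] {P : Measure Ω}
    [IsProbabilityMeasure P] {n : ℕ} {f : Ω → Fin n → ℝ} (hf : ∀ i, Measurable fun ω => f ω i)
    (hf0 : ∀ᵐ ω ∂P, ∀ i, 0 ≤ f ω i) {g : ℝ → ℝ} (hg : IntegrableOn (fun y => 1 - g y) (Ioi 0))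
    (h : ∀ y, 0 < y → P.real {ω | ∀ i, f ω i ≤ y} = g y) :
    Integrable (fun ω => ⨆ i, f ω i) P ∧
      ∫ ω, (⨆ i, f ω i) ∂P = ∫ y in Ioi 0, (1 - g y) := by
  have hlt : ∀ y, 0 < y → P.real {ω | y < ⨆ i, f ω i} = 1 - g y := by
    intro y hy
    have hmeas : MeasurableSet {ω | ∀ i, f ω i ≤ y} := by
      simp only [ofPred_forall]
      exact MeasurableSet.iInter fun i => measurableSet_le (hf i) measurable_const
    rw [← h y hy, ← probReal_compl_eq_one_sub hmeas]
    congr 1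
    ext ω
    exact lt_ciSup_fin_iff (f ω) hy.le
  have h0 : 0 ≤ᵐ[P] fun ω => ⨆ i, f ω i := by
    filter_upwards [hf0] with ω hω
    exact Real.iSup_nonneg hω
  have hint : Integrable (fun ω => ⨆ i, f ω i) P :=
    integrable_of_measureReal_lt_le (Measurable.iSup hf).aemeasurable h0 hg
      fun y hy => (hlt y hy).le
  exact ⟨hint, integral_eq_of_measureReal_lt_eq hint h0 hlt⟩

theorem integrableOn_one_sub_pow {μ : Measure ℝ} {pol : Policy}
    (hT : IntegrableOn (residualTail μ pol) (Ioi 0)) {c : ℝ} (hc0 : 0 ≤ c) (hc1 : c ≤ 1) (k : ℕ) :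
    IntegrableOn (fun y => 1 - (1 - c * residualTail μ pol y) ^ k) (Ioi 0) := by
  refine Integrable.mono' (hT.const_mul (k * c)) ?_ ?_
  · have := (residualTail_antitone μ pol).measurable
    exact Measurable.aestronglyMeasurable (by fun_prop)
  · filter_upwards [ae_restrict_mem measurableSet_Ioi] with y hy
    have h0 := residualTail_nonneg μ pol y
    have h1 := residualTail_le_one μ pol (le_of_lt hy)
    have hc : c * residualTail μ pol y ≤ 1 := mul_le_one₀ hc1 h0 h1
    have hc' : 0 ≤ c * residualTail μ pol y := by positivity
    have hb := one_add_mul_le_pow (a := -(c * residualTail μ pol y)) (by linarith) k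
    rw [← sub_eq_add_neg] at hb
    have hp := pow_le_one₀ (n := k) (sub_nonneg.2 hc) (by linarith)
    rw [Real.norm_of_nonneg (by linarith)]
    linarith

theorem expectedMaxResidual_eq {μ : Measure ℝ} {pol : Policy}
    (hT : IntegrableOn (residualTail μ pol) (Ioi 0)) (k : ℕ) :
    Integrable (fun y : Fin k → ℝ => ⨆ j, y j) (Measure.pi fun _ => residualLaw μ pol) ∧
      expectedMaxResidual μ pol k = ∫ y in Ioi 0, (1 - (1 - residualTail μ pol y) ^ k) := by
  refine integrable_iSup_and_integral_eq (f := fun y : Fin k → ℝ => y) measurable_pi_apply ?_ ?_ ?_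
  · exact ae_all_iff.2 fun j => (measurePreserving_eval (fun _ : Fin k => residualLaw μ pol)
      j).quasiMeasurePreserving.ae (ae_residualLaw_nonneg μ pol)
  · simpa using integrableOn_one_sub_pow hT zero_le_one le_rfl k
  · intro y hy
    have h : {w : Fin k → ℝ | ∀ j, w j ≤ y} = Set.pi univ fun _ => Iic y := by
      ext w
      simp [Pi.le_def]
    have h2 : (residualLaw μ pol).real (Iic y) = 1 - residualTail μ pol y := by
      rw [← residualLaw_real_Ioi μ pol hy.le, ← probReal_compl_eq_one_sub measurableSet_Ioi,
        compl_Ioi]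
    rw [h, measureReal_def, Measure.pi_pi, ENNReal.toReal_prod]
    simp [← measureReal_def, h2]

theorem ae_residual_nonneg {μ : Measure ℝ} [IsProbabilityMeasure μ] (hμ : ∀ᵐ x ∂μ, 0 ≤ x)
    (pol : Policy) (q : ℝ) (n m : ℕ) :
    ∀ᵐ ω ∂(jobLaw μ pol n), ∀ i, 0 ≤ residual pol q m ω.1 ω.2 i := by
  filter_upwards [ae_jobLaw_nonneg hμ pol n] with ω hω i
  exact residual_nonneg pol q m ω.1 hω i

open Classical in
/-- The expected maximum of the residual times.  When the original copies are kept, each of the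
`n` tasks has a positive residual time with probability at most `p`, so that the straggler
count is replaced by a thinning of all `n` tasks. -/
theorem integral_iSup_residual_eq {μ : Measure ℝ} [IsProbabilityMeasure μ]
    (hμ : ∀ᵐ x ∂μ, 0 ≤ x) {pol : Policy} (hT : IntegrableOn (residualTail μ pol) (Ioi 0))
    {n m : ℕ} (hmn : m ≤ n) :
    Integrable (fun ω => ⨆ i, residual pol (quantile μ (1 - pol.p)) m ω.1 ω.2 i)
        (jobLaw μ pol n) ∧
      ∫ ω, (⨆ i, residual pol (quantile μ (1 - pol.p)) m ω.1 ω.2 i) ∂(jobLaw μ pol n) =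
        ∫ y in Ioi 0, (1 - if pol.l = 0 then (1 - residualTail μ pol y) ^ m
          else (1 - pol.p * residualTail μ pol y) ^ n) := by
  refine integrable_iSup_and_integral_eq (f := fun ω : (Fin n → ℝ) ×
    (Fin n → Fin (pol.r + 1) → ℝ) => residual pol (quantile μ (1 - pol.p)) m ω.1 ω.2)
    (measurable_residual pol _ m) (ae_residual_nonneg hμ pol _ n m) ?_ ?_
  · split_ifs
    · simpa using integrableOn_one_sub_pow hT zero_le_one le_rfl m
    · exact integrableOn_one_sub_pow hT pol.p_pos.le pol.p_lt_one.le n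
  · intro y hy
    split_ifs with hl
    · exact measureReal_forall_residual_le_of_l_eq_zero μ hl _ hmn hy.le
    · exact measureReal_forall_residual_le_of_l_eq_one μ ((l_eq_zero_or_one pol).resolve_left hl)
        n m hy.le

theorem sum_measureReal_isStraggler (μ : Measure ℝ) [IsProbabilityMeasure μ] {n m : ℕ}
    (hmn : m ≤ n) :
    ∑ i, (Measure.pi fun _ : Fin n => μ).real {x | IsStraggler m x i} = m := by
  classical
  have h : ∀ i, (Measure.pi fun _ : Fin n => μ).real {x | IsStraggler m x i} =
      ∫ x : Fin n → ℝ, {x | IsStraggler m x i}.indicator (fun _ => (1 : ℝ)) x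
        ∂(Measure.pi fun _ => μ) := fun i => by
    rw [integral_indicator_const _ (measurableSet_isStraggler m i)]
    simp
  rw [Finset.sum_congr rfl fun i _ => h i, ← integral_finsetSum]
  · have hc : ∀ x : Fin n → ℝ,
        ∑ i, {x : Fin n → ℝ | IsStraggler m x i}.indicator (fun _ => (1 : ℝ)) x = m := fun x => by
      simp only [indicator_apply, mem_ofPred_eq]
      rw [Finset.sum_boole, card_isStraggler hmn]
    simp [hc]
  · exact fun i _ => (integrable_const _).indicator (measurableSet_isStraggler m i)

open Classical in
theorem measureReal_lt_residual (μ : Measure ℝ) [IsProbabilityMeasure μ] (pol : Policy)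
    {n : ℕ} (m : ℕ) (i : Fin n) {y : ℝ} (hy : 0 ≤ y) :
    (jobLaw μ pol n).real {ω | y < residual pol (quantile μ (1 - pol.p)) m ω.1 ω.2 i} =
      (if pol.l = 0 then (Measure.pi fun _ : Fin n => μ).real {x | IsStraggler m x i} else pol.p) *
        residualTail μ pol y := by
  set q := quantile μ (1 - pol.p)
  split_ifs with hl
  · have hl1 : ¬ pol.l = 1 := by simp [hl]
    have h : {ω : (Fin n → ℝ) × (Fin n → Fin (pol.r + 1) → ℝ) |
        y < residual pol q m ω.1 ω.2 i} =
        {x | IsStraggler m x i} ×ˢ (Function.eval i ⁻¹' {b | y < residualTime pol q 0 b}) := by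
      ext ω
      simp only [mem_ofPred_eq, mem_prod, mem_preimage, Function.eval, residual, hl1, false_or]
      by_cases hi : IsStraggler m ω.1 i
      · simp [hi, lt_residualTime_iff, IsOriginal, hl1]
      · simp [hi, hy]
    have hm : Measurable fun b => residualTime pol q 0 b :=
      (measurable_residualTime pol q).comp measurable_prodMk_left
    rw [h, jobLaw, measureReal_prod_prod, (measurePreserving_eval _ i).measureReal_preimage
      (measurableSet_lt measurable_const hm).nullMeasurableSet,
      measureReal_lt_residualTime_of_l_eq_zero μ hl]
  · have hl1 := (l_eq_zero_or_one pol).resolve_left hl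
    rw [← measureReal_lt_residualTime_of_l_eq_one μ hl1 hy,
      ← (measurePreserving_task μ pol i).measureReal_preimage
      (measurableSet_lt measurable_const (measurable_residualTime pol q)).nullMeasurableSet]
    congr 1
    ext ω
    simp [residual, hl1, q]

open Classical in
theorem integral_sum_residual_eq {μ : Measure ℝ} [IsProbabilityMeasure μ]
    (hμ : ∀ᵐ x ∂μ, 0 ≤ x) {pol : Policy} (hY : Integrable (fun y : ℝ => y) (residualLaw μ pol))
    {n m : ℕ} (hmn : m ≤ n) :
    (∀ i, Integrable (fun ω => residual pol (quantile μ (1 - pol.p)) m ω.1 ω.2 i)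
        (jobLaw μ pol n)) ∧
      ∑ i, ∫ ω, residual pol (quantile μ (1 - pol.p)) m ω.1 ω.2 i ∂(jobLaw μ pol n) =
        (if pol.l = 0 then (m : ℝ) else n * pol.p) * expectedResidual μ pol := by
  have hT := integrableOn_residualTail hY
  have h0 : ∀ i, 0 ≤ᵐ[jobLaw μ pol n] fun ω =>
      residual pol (quantile μ (1 - pol.p)) m ω.1 ω.2 i := fun i => by
    filter_upwards [ae_residual_nonneg hμ pol (quantile μ (1 - pol.p)) n m] with ω hω
    exact hω i
  have hint : ∀ i, Integrable (fun ω => residual pol (quantile μ (1 - pol.p)) m ω.1 ω.2 i)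
      (jobLaw μ pol n) := fun i =>
    integrable_of_measureReal_lt_le (measurable_residual pol _ m i).aemeasurable (h0 i)
      (hT.const_mul _) fun y hy => (measureReal_lt_residual μ pol m i hy.le).le
  refine ⟨hint, ?_⟩
  rw [Finset.sum_congr rfl fun i _ => integral_eq_of_measureReal_lt_eq (hint i) (h0 i)
    fun y hy => measureReal_lt_residual μ pol m i hy.le]
  simp_rw [integral_const_mul]
  rw [← Finset.sum_mul, expectedResidual_eq hY]
  congr 1
  split_ifs
  · exact sum_measureReal_isStraggler μ hmn
  · simp

/-! ### Comparison of the maximum of `m` variables with a thinned maximum of `n` -/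

theorem pow_sub_one_sub_mul_pow_le {p t : ℝ} (hp0 : 0 < p) (hp1 : p < 1) (ht0 : 0 ≤ t)
    (ht1 : t ≤ 1) {n m : ℕ} (hm : p * n ≤ m + 1) :
    (1 - t) ^ m - (1 - p * t) ^ n ≤ t := by
  have ht : 0 ≤ 1 - t := sub_nonneg.2 ht1
  have h1 : (1 - t) ^ p ≤ 1 - p * t := by
    have := rpow_one_add_le_one_add_mul_self (s := -t) (by linarith) hp0.le hp1.le
    rwa [← sub_eq_add_neg, mul_neg, ← sub_eq_add_neg] at this
  have h2 : (1 - t) ^ (m + 1) ≤ (1 - p * t) ^ n := by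
    rcases eq_or_lt_of_le ht with h0 | h0
    · rw [← h0, zero_pow (by omega)]
      have : p * t ≤ 1 := mul_le_one₀ hp1.le ht0 ht1
      exact pow_nonneg (by linarith) _
    · calc (1 - t) ^ (m + 1) = (1 - t) ^ ((m + 1 : ℕ) : ℝ) := (Real.rpow_natCast _ _).symm
        _ ≤ (1 - t) ^ (p * n) :=
          Real.rpow_le_rpow_of_exponent_ge h0 (by linarith) (by push_cast; exact hm)
        _ = ((1 - t) ^ p) ^ n := by rw [Real.rpow_mul ht, Real.rpow_natCast]
        _ ≤ _ := pow_le_pow_left₀ (Real.rpow_nonneg ht _) h1 n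
  have h3 : (1 - t) ^ m ≤ 1 := pow_le_one₀ ht (by linarith)
  have h4 := mul_le_mul_of_nonneg_left h3 ht0
  rw [pow_succ] at h2
  linarith

theorem one_sub_mul_pow_sub_pow_le {p t : ℝ} (hp0 : 0 < p) (hp1 : p < 1) (ht0 : 0 ≤ t)
    (ht1 : t ≤ 1) {n m : ℕ} (hm : (m : ℝ) ≤ p * n + 1) :
    (1 - p * t) ^ n - (1 - t) ^ m ≤ 4 * t := by
  have hpt : p * t ≤ 1 := mul_le_one₀ hp1.le ht0 ht1
  set e := Real.exp (-(m * t))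
  have he : 0 < e := Real.exp_pos _
  have he1 : e ≤ 1 := Real.exp_le_one_iff.2 (by have := Nat.cast_nonneg (α := ℝ) m; nlinarith)
  -- upper bound of the thinned power by `exp (-(m - 1) t) ≤ e * exp t ≤ e * (1 + 2 t)`
  have h1 : (1 - p * t) ^ n ≤ e * (1 + 2 * t) := by
    calc (1 - p * t) ^ n ≤ Real.exp (-(p * t)) ^ n :=
          pow_le_pow_left₀ (by linarith) (Real.one_sub_le_exp_neg _) n
      _ = Real.exp (-(p * n * t)) := by rw [← Real.exp_nat_mul]; ring_nf
      _ ≤ Real.exp (-(m * t) + t) := Real.exp_le_exp.2 (by nlinarith)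
      _ = e * Real.exp t := Real.exp_add _ _
      _ ≤ e * (1 + 2 * t) := by
        have := Real.abs_exp_sub_one_le (x := t) (by rwa [abs_of_nonneg ht0])
        rw [abs_of_nonneg ht0] at this
        have := (abs_le.1 this).2
        gcongr
        linarith
  -- lower bound `(1 - t) ^ m ≥ e * (1 - m t²)`, from `(1 - t) exp t ≥ 1 - t²`
  have h2 : e * (1 - m * t ^ 2) ≤ (1 - t) ^ m := by
    have hb := one_add_mul_le_pow (a := -t ^ 2) (by nlinarith) m
    have hc : 1 + -t ^ 2 ≤ (1 - t) * Real.exp t := by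
      have := mul_le_mul_of_nonneg_left (Real.add_one_le_exp t) (sub_nonneg.2 ht1)
      linarith [this]
    have hd := pow_le_pow_left₀ (by nlinarith : 0 ≤ 1 + -t ^ 2) hc m
    rw [mul_pow, ← Real.exp_nat_mul] at hd
    have hee : e * Real.exp (m * t) = 1 := by rw [← Real.exp_add]; simp
    calc e * (1 - m * t ^ 2) = e * (1 + m * -t ^ 2) := by ring
      _ ≤ e * ((1 - t) ^ m * Real.exp (m * t)) :=
        mul_le_mul_of_nonneg_left (hb.trans hd) he.le
      _ = (1 - t) ^ m * (e * Real.exp (m * t)) := by ring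
      _ = (1 - t) ^ m := by rw [hee, mul_one]
  have h3 : m * t * e ≤ 1 := by
    have := Real.add_one_le_exp (m * t)
    have hee : e * Real.exp (m * t) = 1 := by rw [← Real.exp_add]; simp
    nlinarith
  have h4 := mul_le_mul_of_nonneg_right h3 ht0
  have h5 := mul_le_mul_of_nonneg_right he1 ht0
  calc (1 - p * t) ^ n - (1 - t) ^ m ≤ e * (1 + 2 * t) - e * (1 - m * t ^ 2) := by linarith
    _ = 2 * (e * t) + m * t * e * t := by ring
    _ ≤ 4 * t := by linarith

/-- The maximum of `m` independent copies of `Y` and the maximum of `n` copies that are replaced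
by `0` with probability `1 - p` have asymptotically equal expectations.  The tails of the two
maxima at a level where `Y` has tail `t` differ by at most `4 t`, although both expectations may
tend to infinity. -/
theorem tendsto_integral_pow_sub_pow {μ : Measure ℝ} {pol : Policy}
    (hT : IntegrableOn (residualTail μ pol) (Ioi 0)) {m : ℕ → ℕ}
    (hm : ∀ n : ℕ, |(m n : ℝ) - pol.p * n| < 1) :
    Tendsto (fun n : ℕ => ∫ y in Ioi 0, ((1 - residualTail μ pol y) ^ m n -
      (1 - pol.p * residualTail μ pol y) ^ n)) atTop (𝓝 0) := by
  have hp := pol.p_pos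
  have hp1 := pol.p_lt_one
  have hmT : Tendsto m atTop atTop := by
    have h1 := (tendsto_natCast_atTop_atTop (R := ℝ)).const_mul_atTop hp
    have h2 : Tendsto (fun n => (m n : ℝ)) atTop atTop := by
      refine tendsto_atTop_mono (fun n => ?_) (tendsto_atTop_add_const_right _ (-1) h1)
      linarith [abs_lt.1 (hm n)]
    exact tendsto_natCast_atTop_iff.1 h2
  have hTm := (residualTail_antitone μ pol).measurable
  have hdct := tendsto_integral_filter_of_dominated_convergence
    (μ := volume.restrict (Ioi (0 : ℝ))) (l := atTop)
    (F := fun (n : ℕ) y => (1 - residualTail μ pol y) ^ m n -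
      (1 - pol.p * residualTail μ pol y) ^ n) (f := fun _ => 0)
    (fun y => 4 * residualTail μ pol y)
    (Eventually.of_forall fun n => Measurable.aestronglyMeasurable (by fun_prop))
    (by
      refine Eventually.of_forall fun n => ?_
      filter_upwards [ae_restrict_mem measurableSet_Ioi] with y hy
      have h0 := residualTail_nonneg μ pol y
      have h1 := residualTail_le_one μ pol (le_of_lt hy)
      have hmn := abs_lt.1 (hm n)
      rw [Real.norm_eq_abs, abs_le]
      constructor
      · linarith [one_sub_mul_pow_sub_pow_le hp hp1 h0 h1 (n := n) (m := m n) (by linarith)]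
      · linarith [pow_sub_one_sub_mul_pow_le hp hp1 h0 h1 (n := n) (m := m n) (by linarith)])
    (hT.const_mul 4)
    (by
      filter_upwards [ae_restrict_mem measurableSet_Ioi] with y hy
      have h0 := residualTail_nonneg μ pol y
      have h1 := residualTail_le_one μ pol (le_of_lt hy)
      rcases eq_or_lt_of_le h0 with h | h
      · simp [← h]
      · have hpt : 0 < pol.p * residualTail μ pol y := mul_pos hp h
        have hpt1 : pol.p * residualTail μ pol y ≤ 1 := mul_le_one₀ hp1.le h0 h1
        have ha := (tendsto_pow_atTop_nhds_zero_of_lt_one (sub_nonneg.2 h1)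
          (by linarith : 1 - residualTail μ pol y < 1)).comp hmT
        have hb := tendsto_pow_atTop_nhds_zero_of_lt_one (sub_nonneg.2 hpt1)
          (by linarith : 1 - pol.p * residualTail μ pol y < 1)
        simpa using ha.sub hb)
  simpa using hdct

/-! ### The quantile transform -/

theorem monotoneOn_quantile {μ : Measure ℝ} [IsProbabilityMeasure μ] (hμ : ∀ᵐ x ∂μ, 0 ≤ x) :
    MonotoneOn (quantile μ) (Ioo 0 1) := fun _ ha _ hb hab =>
  (quantile_le_iff hμ ha.1 ha.2 _).2 (hab.trans ((quantile_le_iff hμ hb.1 hb.2 _).1 le_rfl))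

theorem aemeasurable_quantile {μ : Measure ℝ} [IsProbabilityMeasure μ] (hμ : ∀ᵐ x ∂μ, 0 ≤ x) :
    AEMeasurable (quantile μ) (volume.restrict (Ioo 0 1)) :=
  aemeasurable_restrict_of_monotoneOn measurableSet_Ioo (monotoneOn_quantile hμ)

/-- The quantile function of a uniform random variable has law `μ`. -/
theorem map_quantile {μ : Measure ℝ} [IsProbabilityMeasure μ] (hμ : ∀ᵐ x ∂μ, 0 ≤ x) :
    (volume.restrict (Ioo (0 : ℝ) 1)).map (quantile μ) = μ := by
  have hprob : IsProbabilityMeasure (volume.restrict (Ioo (0 : ℝ) 1)) := ⟨by simp⟩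
  have hmap := Measure.isProbabilityMeasure_map (aemeasurable_quantile hμ)
  refine Measure.eq_of_cdf _ _ (StieltjesFunction.ext fun x => ?_)
  rw [cdf_eq_real, measureReal_def,
    Measure.map_apply_of_aemeasurable (aemeasurable_quantile hμ) measurableSet_Iic,
    Measure.restrict_apply' measurableSet_Ioo]
  have h0 := cdf_nonneg μ x
  have hset : quantile μ ⁻¹' Iic x ∩ Ioo 0 1 = Iic (cdf μ x) ∩ Ioo 0 1 := by
    ext h
    simp only [mem_inter_iff, mem_preimage, mem_Iic]
    exact and_congr_left fun hh => quantile_le_iff hμ hh.1 hh.2 x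
  rw [hset]
  have hvol : volume (Iic (cdf μ x) ∩ Ioo 0 1) = ENNReal.ofReal (cdf μ x) := by
    refine le_antisymm ?_ ?_
    · calc volume (Iic (cdf μ x) ∩ Ioo 0 1) ≤ volume (Ioc 0 (cdf μ x)) :=
            measure_mono fun h hh => ⟨hh.2.1, hh.1⟩
        _ = _ := by simp
    · calc ENNReal.ofReal (cdf μ x) = volume (Ioo 0 (cdf μ x)) := by simp
        _ ≤ volume (Iic (cdf μ x) ∩ Ioo 0 1) :=
          measure_mono fun h hh => ⟨hh.2.le, hh.1, hh.2.trans_le (cdf_le_one μ x)⟩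
  rw [hvol, ENNReal.toReal_ofReal h0]

theorem integrable_min {μ : Measure ℝ} [IsProbabilityMeasure μ] (hμ : ∀ᵐ x ∂μ, 0 ≤ x)
    {q : ℝ} (hq : 0 ≤ q) : Integrable (fun x => min x q) μ := by
  refine Integrable.mono' (integrable_const q) (by fun_prop) ?_
  filter_upwards [hμ] with x hx
  rw [Real.norm_of_nonneg (le_min hx hq)]
  exact min_le_right _ _

theorem integral_min_quantile {μ : Measure ℝ} [IsProbabilityMeasure μ] (hμ : ∀ᵐ x ∂μ, 0 ≤ x)
    {p : ℝ} (hp0 : 0 < p) (hp1 : p < 1) :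
    ∫ x, min x (quantile μ (1 - p)) ∂μ =
      (∫ h in (0 : ℝ)..(1 - p), quantile μ h) + p * quantile μ (1 - p) := by
  set q := quantile μ (1 - p) with hqdef
  have hq0 : 0 ≤ q := quantile_nonneg hμ (by linarith)
  have hmem : 1 - p ∈ Ioo (0 : ℝ) 1 := ⟨by linarith, by linarith⟩
  have hmono := monotoneOn_quantile hμ
  have hint : IntegrableOn (fun h => min (quantile μ h) q) (Ioo 0 1) := by
    have h := integrable_min hμ hq0
    rw [← map_quantile hμ] at h
    exact h.comp_aemeasurable (aemeasurable_quantile hμ)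
  have hm : AEStronglyMeasurable (fun x : ℝ => min x q)
      ((volume.restrict (Ioo (0 : ℝ) 1)).map (quantile μ)) := by fun_prop
  conv_lhs => rw [← map_quantile hμ]
  rw [integral_map (aemeasurable_quantile hμ) hm]
  have hunion : Ioc 0 (1 - p) ∪ Ioo (1 - p) 1 = Ioo (0 : ℝ) 1 :=
    Ioc_union_Ioo_eq_Ioo hmem.1.le hmem.2
  have hdisj : Disjoint (Ioc 0 (1 - p)) (Ioo (1 - p) 1) :=
    Set.disjoint_left.2 fun h h1 h2 => not_lt.2 h1.2 h2.1
  rw [← hunion] at hint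
  rw [← hunion, setIntegral_union hdisj measurableSet_Ioo hint.left_of_union hint.right_of_union,
    intervalIntegral.integral_of_le hmem.1.le]
  congr 1
  · refine setIntegral_congr_fun measurableSet_Ioc fun h hh => ?_
    exact min_eq_left (hmono ⟨hh.1, hh.2.trans_lt hmem.2⟩ hmem hh.2)
  · rw [setIntegral_congr_fun (g := fun _ => q) measurableSet_Ioo fun h hh =>
      min_eq_right (hmono hmem ⟨hmem.1.trans hh.1, hh.2⟩ hh.1.le)]
    simp [hp0.le]

/-! ### Expected latency and cost -/

theorem integrable_and_abs_integral_sub_le {Ω : Type*} [MeasurableSpace Ω] {P : Measure Ω}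
    {f g d : Ω → ℝ} (hf : AEStronglyMeasurable f P) (hg : Integrable g P) (hd : Integrable d P)
    (h : ∀ᵐ ω ∂P, |f ω - g ω| ≤ d ω) :
    Integrable f P ∧ |∫ ω, f ω ∂P - ∫ ω, g ω ∂P| ≤ ∫ ω, d ω ∂P := by
  have hfg : Integrable (fun ω => f ω - g ω) P :=
    hd.mono' (hf.sub hg.aestronglyMeasurable) h
  have hfi : Integrable f P := (hfg.add hg).congr (ae_of_all _ fun ω => by simp)
  refine ⟨hfi, ?_⟩
  rw [← integral_sub hfi hg, ← Real.norm_eq_abs]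
  exact norm_integral_le_of_norm_le hd h

theorem tendsto_straggler_fraction {p : ℝ} {m : ℕ → ℕ}
    (hm : ∀ n : ℕ, |(m n : ℝ) - p * n| < 1) :
    Tendsto (fun n : ℕ => (m n : ℝ) / n) atTop (𝓝 p) := by
  have hlim := tendsto_const_div_atTop_nhds_zero_nat (1 : ℝ)
  rw [tendsto_iff_dist_tendsto_zero]
  refine squeeze_zero' (Eventually.of_forall fun _ => dist_nonneg) ?_ hlim
  filter_upwards [eventually_gt_atTop 0] with n hn
  have hn' : (0 : ℝ) < n := by exact_mod_cast hn
  rw [Real.dist_eq, show (m n : ℝ) / n - p = (m n - p * n) / n by field_simp, abs_div,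
    abs_of_pos hn']
  gcongr
  exact (hm n).le

theorem latency_bounds {μ : Measure ℝ} [IsProbabilityMeasure μ] (hμ : ∀ᵐ x ∂μ, 0 ≤ x)
    {pol : Policy} (hY : Integrable (fun y : ℝ => y) (residualLaw μ pol)) {n m : ℕ} (hm : 0 < m)
    (hmn : m < n) (hD : Integrable (fun x : Fin n → ℝ =>
      |forkTime m x - quantile μ (1 - pol.p)|) (Measure.pi fun _ => μ)) :
    Integrable (fun ω => latency pol m ω.1 ω.2) (jobLaw μ pol n) ∧
      |expectedLatency μ pol n m - (quantile μ (1 - pol.p) +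
        ∫ ω, (⨆ i, residual pol (quantile μ (1 - pol.p)) m ω.1 ω.2 i) ∂(jobLaw μ pol n))| ≤
      2 * ∫ x : Fin n → ℝ, |forkTime m x - quantile μ (1 - pol.p)| ∂(Measure.pi fun _ => μ) := by
  set q := quantile μ (1 - pol.p) with hq
  have hU := (integral_iSup_residual_eq hμ (integrableOn_residualTail hY) hmn.le).1
  rw [← hq] at hU
  have hD' : Integrable (fun ω : (Fin n → ℝ) × (Fin n → Fin (pol.r + 1) → ℝ) =>
      |forkTime m ω.1 - q|) (jobLaw μ pol n) := hD.comp_fst _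
  have h := integrable_and_abs_integral_sub_le (measurable_latency pol n m).aestronglyMeasurable
    ((integrable_const q).add hU) (hD'.const_mul 2) (by
      filter_upwards [ae_jobLaw_nonneg hμ pol n] with ω hω
      exact abs_latency_sub_le pol q hm hmn hω)
  refine ⟨h.1, ?_⟩
  have h2 := h.2
  have h3 : ∫ ω, |forkTime m ω.1 - q| ∂(jobLaw μ pol n) =
      ∫ x : Fin n → ℝ, |forkTime m x - q| ∂(Measure.pi fun _ => μ) := by
    rw [jobLaw, integral_fun_fst (fun x : Fin n → ℝ => |forkTime m x - q|)]
    simp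
  simp only [Pi.add_apply] at h2
  rw [integral_add (integrable_const q) hU, integral_const_mul, h3] at h2
  simpa [expectedLatency] using h2

open Classical in
theorem cost_bounds {μ : Measure ℝ} [IsProbabilityMeasure μ] (hμ : ∀ᵐ x ∂μ, 0 ≤ x)
    {pol : Policy} (hY : Integrable (fun y : ℝ => y) (residualLaw μ pol)) {n m : ℕ}
    (hmn : m < n) (hD : Integrable (fun x : Fin n → ℝ =>
      |forkTime m x - quantile μ (1 - pol.p)|) (Measure.pi fun _ => μ)) :
    Integrable (fun ω => cost pol m ω.1 ω.2) (jobLaw μ pol n) ∧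
      |expectedCost μ pol n m - (∫ x, min x (quantile μ (1 - pol.p)) ∂μ + (pol.r + 1) *
        (if pol.l = 0 then (m : ℝ) / n else pol.p) * expectedResidual μ pol)| ≤
      (pol.r + 2) *
        ∫ x : Fin n → ℝ, |forkTime m x - quantile μ (1 - pol.p)| ∂(Measure.pi fun _ => μ) := by
  have hn : (n : ℝ) ≠ 0 := by
    have : n ≠ 0 := by omega
    exact_mod_cast this
  have hU := integral_sum_residual_eq hμ hY hmn.le
  have hq0 : 0 ≤ quantile μ (1 - pol.p) := quantile_nonneg hμ (sub_pos.2 pol.p_lt_one)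
  set q := quantile μ (1 - pol.p) with hq
  have hmp : ∀ i : Fin n, MeasurePreserving
      (fun ω : (Fin n → ℝ) × (Fin n → Fin (pol.r + 1) → ℝ) => ω.1 i) (jobLaw μ pol n) μ :=
    fun i => measurePreserving_fst.comp (measurePreserving_task μ pol i)
  have hmin := integrable_min hμ hq0
  have hmini : ∀ i : Fin n, Integrable (fun ω : (Fin n → ℝ) × (Fin n → Fin (pol.r + 1) → ℝ) =>
      min (ω.1 i) q) (jobLaw μ pol n) := fun i => (hmp i).integrable_comp_of_integrable hmin
  have hmineq : ∀ i : Fin n, ∫ ω, min (ω.1 i) q ∂(jobLaw μ pol n) = ∫ x, min x q ∂μ := by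
    intro i
    have h := integral_map (μ := jobLaw μ pol n) (hmp i).measurable.aemeasurable (f := fun x => min x q)
      (by fun_prop)
    rw [(hmp i).map_eq] at h
    exact h.symm
  have hterm : ∀ i : Fin n, Integrable (fun ω : (Fin n → ℝ) × (Fin n → Fin (pol.r + 1) → ℝ) =>
      min (ω.1 i) q + (pol.r + 1) * residual pol q m ω.1 ω.2 i) (jobLaw μ pol n) :=
    fun i => (hmini i).add ((hU.1 i).const_mul _)
  have hD' : Integrable (fun ω : (Fin n → ℝ) × (Fin n → Fin (pol.r + 1) → ℝ) =>
      |forkTime m ω.1 - q|) (jobLaw μ pol n) := hD.comp_fst _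
  have h3 : ∫ ω, |forkTime m ω.1 - q| ∂(jobLaw μ pol n) =
      ∫ x : Fin n → ℝ, |forkTime m x - q| ∂(Measure.pi fun _ => μ) := by
    rw [jobLaw, integral_fun_fst (fun x : Fin n → ℝ => |forkTime m x - q|)]
    simp
  have h := integrable_and_abs_integral_sub_le (measurable_cost pol n m).aestronglyMeasurable
    ((integrable_finsetSum Finset.univ fun i _ => hterm i).const_mul (1 / (n : ℝ)))
    (hD'.const_mul (pol.r + 2)) (by
      filter_upwards [ae_jobLaw_nonneg hμ pol n] with ω hω
      exact abs_cost_sub_le pol q hmn hω)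
  refine ⟨h.1, ?_⟩
  have h2 := h.2
  rw [integral_const_mul, integral_const_mul, h3, integral_finsetSum _ fun i _ => hterm i,
    Finset.sum_congr rfl fun i _ => integral_add (hmini i) ((hU.1 i).const_mul _),
    Finset.sum_add_distrib, Finset.sum_congr rfl fun i _ => hmineq i] at h2
  simp_rw [integral_const_mul] at h2
  rw [← Finset.mul_sum, hU.2, Finset.sum_const, Finset.card_univ, Fintype.card_fin,
    nsmul_eq_mul] at h2
  refine le_of_eq_of_le ?_ h2
  rw [expectedCost]
  congr 2
  split_ifs <;> field_simp

theorem tendsto_integral_iSup_residual_sub {μ : Measure ℝ} [IsProbabilityMeasure μ]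
    (hμ : ∀ᵐ x ∂μ, 0 ≤ x) {pol : Policy} (hT : IntegrableOn (residualTail μ pol) (Ioi 0))
    {m : ℕ → ℕ} (hm : ∀ n : ℕ, |(m n : ℝ) - pol.p * n| < 1) :
    Tendsto (fun n : ℕ => ∫ ω, (⨆ i, residual pol (quantile μ (1 - pol.p)) (m n) ω.1 ω.2 i)
      ∂(jobLaw μ pol n) - expectedMaxResidual μ pol (m n)) atTop (𝓝 0) := by
  by_cases hl : pol.l = 0
  · refine tendsto_const_nhds.congr' ?_
    filter_upwards [eventually_straggler_bounds pol hm] with n hn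
    rw [(integral_iSup_residual_eq hμ hT hn.2.1.le).2, (expectedMaxResidual_eq hT (m n)).2]
    simp [hl]
  · refine (tendsto_integral_pow_sub_pow hT hm).congr' ?_
    filter_upwards [eventually_straggler_bounds pol hm] with n hn
    rw [(integral_iSup_residual_eq hμ hT hn.2.1.le).2, (expectedMaxResidual_eq hT (m n)).2]
    simp only [hl, if_false]
    rw [← integral_sub (integrableOn_one_sub_pow hT pol.p_pos.le pol.p_lt_one.le n)
      (by simpa [IntegrableOn] using integrableOn_one_sub_pow hT zero_le_one le_rfl (m n))]
    simp

end SingleFork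

theorem theorem1 (μ : Measure ℝ) [IsProbabilityMeasure μ] (hμ : ∀ᵐ x ∂μ, 0 ≤ x)
    (pol : SingleFork.Policy)
    (hq : ∀ y : ℝ, SingleFork.quantile μ (1 - pol.p) < y → 1 - pol.p < cdf μ y)
    (hY : Integrable (fun y : ℝ => y) (SingleFork.residualLaw μ pol))
    (m : ℕ → ℕ) (hm : ∀ n : ℕ, |(m n : ℝ) - pol.p * n| < 1) :
    (∀ᶠ n : ℕ in atTop,
      Integrable (fun ω => SingleFork.latency pol (m n) ω.1 ω.2) (SingleFork.jobLaw μ pol n) ∧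
      Integrable (fun ω => SingleFork.cost pol (m n) ω.1 ω.2) (SingleFork.jobLaw μ pol n) ∧
      Integrable (fun y : Fin (m n) → ℝ => ⨆ j, y j)
        (Measure.pi fun _ => SingleFork.residualLaw μ pol)) ∧
    Tendsto (fun n : ℕ => SingleFork.expectedLatency μ pol n (m n) -
        (SingleFork.quantile μ (1 - pol.p) + SingleFork.expectedMaxResidual μ pol (m n)))
      atTop (𝓝 0) ∧
    Tendsto (fun n : ℕ => SingleFork.expectedCost μ pol n (m n)) atTop
      (𝓝 ((∫ h in (0 : ℝ)..(1 - pol.p), SingleFork.quantile μ h) +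
        pol.p * SingleFork.quantile μ (1 - pol.p) +
        ((pol.r : ℝ) + 1) * pol.p * SingleFork.expectedResidual μ pol)) := by
  classical
  open SingleFork in
  have hT := integrableOn_residualTail hY
  obtain ⟨hDint, hD⟩ := tendsto_integral_abs_forkTime_sub hμ pol hq hY hm
  have hev := eventually_straggler_bounds pol hm
  refine ⟨?_, ?_, ?_⟩
  · filter_upwards [hev, hDint] with n hn hDn
    exact ⟨(latency_bounds hμ hY hn.1 hn.2.1 hDn).1, (cost_bounds hμ hY hn.2.1 hDn).1,
      (expectedMaxResidual_eq hT (m n)).1⟩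
  · have h1 : Tendsto (fun n : ℕ => expectedLatency μ pol n (m n) - (quantile μ (1 - pol.p) +
        ∫ ω, (⨆ i, residual pol (quantile μ (1 - pol.p)) (m n) ω.1 ω.2 i) ∂(jobLaw μ pol n)))
        atTop (𝓝 0) := by
      have hD2 := hD.const_mul 2
      rw [mul_zero] at hD2
      refine squeeze_zero_norm' ?_ hD2
      filter_upwards [hev, hDint] with n hn hDn
      exact (latency_bounds hμ hY hn.1 hn.2.1 hDn).2
    have h2 := h1.add (tendsto_integral_iSup_residual_sub hμ hT hm)
    rw [add_zero] at h2
    exact h2.congr fun n => by ring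
  · have hfrac : Tendsto (fun n : ℕ => if pol.l = 0 then (m n : ℝ) / n else pol.p) atTop
        (𝓝 pol.p) := by
      split_ifs
      · exact tendsto_straggler_fraction hm
      · exact tendsto_const_nhds
    have h1 := ((hfrac.const_mul ((pol.r : ℝ) + 1)).mul_const (expectedResidual μ pol)).const_add
      (∫ x, min x (quantile μ (1 - pol.p)) ∂μ)
    have hD2 := hD.const_mul ((pol.r : ℝ) + 2)
    rw [mul_zero] at hD2
    have h2 : Tendsto (fun n : ℕ => expectedCost μ pol n (m n) -
        (∫ x, min x (quantile μ (1 - pol.p)) ∂μ + (pol.r + 1) *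
        (if pol.l = 0 then (m n : ℝ) / n else pol.p) * expectedResidual μ pol)) atTop (𝓝 0) := by
      refine squeeze_zero_norm' ?_ hD2
      filter_upwards [hev, hDint] with n hn hDn
      exact (cost_bounds hμ hY hn.2.1 hDn).2
    have h3 := h2.add h1
    rw [zero_add, integral_min_quantile hμ pol.p_pos pol.p_lt_one] at h3
    exact h3.congr fun n => by ring
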